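/- **Setting.** Let $X_i=(Y_i,W_i,Z_i)$, $i\ge 1$, be i.i.d. with $Z_i\in[0,1]$, from a conditionally parametric model: given $W=w$, $Z=z$, the variable $Y$ has density $lik(\cdot\,;\theta,\eta(z))$ (which may depend on $w,z$) with respect to a $\sigma$-finite measure, where $\theta\in\Theta\subset\mathbb R^d$ and $\eta(z)\in H\subset\mathbb R$, and the law of $(W,Z)$ does not depend on $(\theta,\eta)$. Let $\mathcal H=\{h\in C^2[0,1]: h(z)\in \mathrm{int}(H)\ \text{for all } z\}$, let $(\theta_0,\eta_0)$ with $\theta_0\in\mathrm{int}(\Theta)$, $\eta_0\in\mathcal H$ be the true parameter, and let $E$ be the expectation under it. Let $\mathcal N\subset\Theta$ be an open neighbourhood of $\theta_0$. For $\theta\in\mathcal N$ let $\eta_*(\theta)\in\mathcal H$ be a maximizer over $\eta\in\mathcal H$ of $E[\log lik(X;\theta,\eta(Z))\mid Z]$ (the least favourable curve), and let $\widehat\eta(\theta)=\widehat\eta_n(\theta)\in\mathcal H$ be its kernel estimate: for every $z\in[0,1]$, $\widehat\eta(\theta)(z)$ maximizes $$\lambda\mapsto\sum_{i=1}^n\log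 lik(X_i;\theta,\lambda)\,K\Big(\frac{z-Z_i}{b_n}\Big)$$ over $\mathrm{int}(H)$, where $K$ is a kernel ($\int K=1$) and $0<b_n\to 0$ (with probability tending to one such an estimate exists for all $\theta\in\mathcal N$). Put $$\widehat S_n(\theta)=\sum_{i=1}^n\log lik(X_i;\theta,\widehat\eta(\theta)(Z_i)),\qquad S_n(\theta)=\sum_{i=1}^n\log lik(X_i;\theta,\eta_*(\theta)(Z_i)).$$ A superscript $(s)$ denotes the $s$-th derivative in $\theta$, and $\|\cdot\|_\infty$ is the supremum over $z\in[0,1]$. Stochastic orders are understood in outer probability. **Conditions.** * **K1.** For all $\theta_1\in\Theta$, $\lambda_1\in H$, and all $\theta\in\Theta$, $\lambda\in H$ with $\theta\ne\theta_1$: $E_{\theta_1,\lambda_1}\log lik(X;\theta,\lambda)<E_{\theta_1,\lambda_1}\log lik(X;\theta_1,\lambda_1)$. * **K2.** Almost surely, $\log lik(X;\theta,\lambda)$ is finite and four times continuously differentiable in $(\theta,\lambda)$ on $\mathrm{int}(\Theta)\times\mathrm{int}(H)$, and $$E\Big\{\sup_{(\theta,\lambda)\in\mathrm{int}(\Theta)\times\mathrm{int}(H)}\Big|\frac{\partial^{r+s}\log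 lik(X;\theta,\lambda)}{\partial\theta^r\partial\lambda^s}\Big|^2\Big\}<\infty\qquad\text{for all } r,s\ge0,\ r+s\le 4.$$ * **C1.** For all $r,s\ge0$ with $r+s\le3$, the derivatives $\frac{\partial^{r+s}}{\partial z^r\partial\theta^s}\eta_*(\theta)(z)$ and, with probability tending to one, $\frac{\partial^{r+s}}{\partial z^r\partial\theta^s}\widehat\eta(\theta)(z)$ exist for $\theta\in\mathcal N$, $z\in[0,1]$, and $\sup_{\theta\in\mathcal N}\|\eta_*^{(s)}(\theta)\|_\infty<\infty$ for $s=0,1,2,3$. * **C2.** For some $g\in(1/4,1/2]$ and $2g-1/2\le\delta\le g$: $\sup_{\theta\in\mathcal N}\|\widehat\eta^{(s)}(\theta)-\eta_*^{(s)}(\theta)\|_\infty=O_P(n^{-g})$ for $s=0,1,2$; $\sup_{\theta\in\mathcal N}\|\widehat\eta^{(3)}(\theta)-\eta_*^{(3)}(\theta)\|_\infty=o_P(1)$; and $\big\|\frac{\partial}{\partial z}\widehat\eta^{(s)}(\theta_0)-\frac{\partial}{\partial z}\eta_*^{(s)}(\theta_0)\big\|_\infty=o_P(n^{-\delta})$ for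 $s=0,1$. **Theorem 4.** Assume K1, K2, C1 and C2. Then Condition G holds with the same $g$: there is an open neighbourhood $\mathcal N'\subset\mathcal N$ of $\theta_0$ (one may take $\mathcal N'=\mathcal N$ if $H$ is an interval) such that, with probability tending to one, $\widehat S_n$ and $S_n$ are three times differentiable on $\mathcal N'$, and $$\Big|\tfrac1n\widehat S_n^{(1)}(\theta_0)-\tfrac1nS_n^{(1)}(\theta_0)\Big|=O_P(n^{-2g}),$$ $$\sup_{\theta\in\mathcal N'}\Big|\tfrac1n\widehat S_n^{(2)}(\theta)-\tfrac1nS_n^{(2)}(\theta)\Big|=O_P(n^{-g}),\qquad \sup_{\theta\in\mathcal N'}\Big|\tfrac1n\widehat S_n^{(3)}(\theta)\Big|=O_P(1),$$ where $1/4<g\le1/2$. -/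

import Mathlib

open MeasureTheory ProbabilityTheory Filter Topology Set
open scoped ENNReal NNReal

noncomputable section

/-- Stochastic order `R n = O_P(r n)` for a sequence of nonnegative (possibly infinite) random
quantities. The measure of an arbitrary set is its outer measure, so no measurability is needed. -/
def BigOP {Ω : Type*} [MeasurableSpace Ω] (μ : Measure Ω) (R : ℕ → Ω → ℝ≥0∞) (r : ℕ → ℝ) : Prop :=
  ∀ ε : ℝ, 0 < ε → ∃ M : ℝ, ∀ᶠ n in atTop,
    μ {ω | ENNReal.ofReal (M * r n) < R n ω} ≤ ENNReal.ofReal ε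

/-- Stochastic order `R n = o_P(r n)`. -/
def LittleOP {Ω : Type*} [MeasurableSpace Ω] (μ : Measure Ω) (R : ℕ → Ω → ℝ≥0∞) (r : ℕ → ℝ) :
    Prop :=
  ∀ c : ℝ, 0 < c →
    Tendsto (fun n => μ {ω | ENNReal.ofReal (c * r n) < R n ω}) atTop (𝓝 0)

/-- The statement `G n ω` holds with probability tending to one as `n → ∞`. -/
def WithProbTendingToOne {Ω : Type*} [MeasurableSpace Ω] (μ : Measure Ω) (G : ℕ → Ω → Prop) :
    Prop :=
  Tendsto (fun n => μ {ω | ¬ G n ω}) atTop (𝓝 0)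

/-- `f` is three times (Fréchet) differentiable on the open set `N`. -/
def ThriceDifferentiableOn {d : ℕ} (f : EuclideanSpace ℝ (Fin d) → ℝ)
    (N : Set (EuclideanSpace ℝ (Fin d))) : Prop :=
  ∀ k < 3, DifferentiableOn ℝ (iteratedFDeriv ℝ k f) N

/-- A curve `θ ↦ η(θ)` of functions on `[0,1]` is given as `η θ z`. `thetaDeriv η s θ z` is the
`s`-th derivative of `η(θ)(z)` with respect to `θ` (an `s`-linear form). -/
def thetaDeriv {d : ℕ} (η : EuclideanSpace ℝ (Fin d) → ℝ → ℝ) (s : ℕ)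
    (θ : EuclideanSpace ℝ (Fin d)) (z : ℝ) :
    ContinuousMultilinearMap ℝ (fun _ : Fin s => EuclideanSpace ℝ (Fin d)) ℝ :=
  iteratedFDeriv ℝ s (fun t => η t z) θ

/-- All derivatives `∂^{r+s} η(θ)(z) / ∂z^r ∂θ^s` with `r + s ≤ 3` exist for `θ ∈ N` and
`z ∈ [0,1]` (one-sided in `z` at the two end points). -/
def MixedDerivsExist {d : ℕ} (η : EuclideanSpace ℝ (Fin d) → ℝ → ℝ)
    (N : Set (EuclideanSpace ℝ (Fin d))) : Prop :=
  (∀ z ∈ Icc (0 : ℝ) 1, ThriceDifferentiableOn (fun θ => η θ z) N) ∧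
  ∀ θ ∈ N, ∀ r s : ℕ, r + s < 3 →
    DifferentiableOn ℝ (iteratedDerivWithin r (fun z => thetaDeriv η s θ z) (Icc 0 1)) (Icc 0 1)

/-- A conditionally parametric model for observations `X = (Y, (W, Z))` with `Z ∈ [0,1]`: given
`W = w` and `Z = z`, the variable `Y` has a `ν`-density from a family indexed by `θ ∈ Θ ⊆ ℝ^d` and
`λ = η(z) ∈ H ⊆ ℝ`; the law `Q` of `(W, Z)` does not depend on the parameters. -/
structure CondParamModel (d : ℕ) (𝒴 𝒲 : Type*) [MeasurableSpace 𝒴] [MeasurableSpace 𝒲] where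
  /-- parameter space of `θ` -/
  Θ : Set (EuclideanSpace ℝ (Fin d))
  /-- parameter space of `λ` -/
  H : Set ℝ
  /-- dominating measure for `Y` -/
  ν : Measure 𝒴
  sigmaFinite_ν : SigmaFinite ν
  /-- joint law of the covariates `(W, Z)` -/
  Q : Measure (𝒲 × unitInterval)
  isProbabilityMeasure_Q : IsProbabilityMeasure Q
  /-- `lik (y, (w, z)) θ l`: conditional density of `Y` at `y` given `W = w`, `Z = z` -/
  lik : 𝒴 × (𝒲 × unitInterval) → EuclideanSpace ℝ (Fin d) → ℝ → ℝ≥0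
  measurable_lik : ∀ θ ∈ Θ,
    Measurable fun p : (𝒴 × (𝒲 × unitInterval)) × H => lik p.1 θ (p.2 : ℝ)
  lintegral_lik : ∀ θ ∈ Θ, ∀ l ∈ H, ∀ v : 𝒲 × unitInterval,
    ∫⁻ y, (lik (y, v) θ l : ℝ≥0∞) ∂ν = 1

namespace CondParamModel

variable {d : ℕ} {𝒴 𝒲 : Type*} [MeasurableSpace 𝒴] [MeasurableSpace 𝒲]

/-- The log-likelihood `log lik(x; θ, λ)`. -/
def loglik (M : CondParamModel d 𝒴 𝒲) (x : 𝒴 × (𝒲 × unitInterval))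
    (θ : EuclideanSpace ℝ (Fin d)) (l : ℝ) : ℝ :=
  Real.log (M.lik x θ l)

/-- The nuisance space: the twice continuously differentiable functions on `[0,1]` with values in
the interior of `H`. -/
def nuisanceSpace (M : CondParamModel d 𝒴 𝒲) : Set (ℝ → ℝ) :=
  {h | ContDiffOn ℝ 2 h (Icc 0 1) ∧ ∀ z ∈ Icc (0 : ℝ) 1, h z ∈ interior M.H}

/-- The law of one observation `X = (Y, (W, Z))` under the parameter `(θ, η)`. -/
def law (M : CondParamModel d 𝒴 𝒲) (θ : EuclideanSpace ℝ (Fin d)) (η : ℝ → ℝ) :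
    Measure (𝒴 × (𝒲 × unitInterval)) :=
  (M.ν.prod M.Q).withDensity fun x => (M.lik x θ (η x.2.2) : ℝ≥0∞)

/-- `X 0, X 1, …` are i.i.d. observations from the model at `(θ, η)`. -/
def IsSample (M : CondParamModel d 𝒴 𝒲) (θ : EuclideanSpace ℝ (Fin d)) (η : ℝ → ℝ)
    {Ω : Type*} [MeasurableSpace Ω] (μ : Measure Ω) (X : ℕ → Ω → 𝒴 × (𝒲 × unitInterval)) : Prop :=
  (∀ i, Measurable (X i)) ∧ iIndepFun X μ ∧ ∀ i, μ.map (X i) = M.law θ η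

/-- Identifiability. If `log lik(·; θ, λ)` is not integrable under `(θ₁, λ₁)`, or equals `-∞` with
positive probability, then its expectation is `-∞` and the inequality holds by convention. -/
def ConditionK1 (M : CondParamModel d 𝒴 𝒲) : Prop :=
  ∀ θ₁ ∈ M.Θ, ∀ l₁ ∈ M.H, ∀ θ ∈ M.Θ, ∀ l ∈ M.H, θ ≠ θ₁ →
    Integrable (fun x => M.loglik x θ₁ l₁) (M.law θ₁ fun _ => l₁) ∧
    ((∀ᵐ x ∂(M.law θ₁ fun _ => l₁), 0 < M.lik x θ l) →
      Integrable (fun x => M.loglik x θ l) (M.law θ₁ fun _ => l₁) →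
      ∫ x, M.loglik x θ l ∂(M.law θ₁ fun _ => l₁) <
        ∫ x, M.loglik x θ₁ l₁ ∂(M.law θ₁ fun _ => l₁))

/-- Smoothness and moments: almost surely `(θ, λ) ↦ log lik(X; θ, λ)` is finite and of class `C⁴`,
and for each `k ≤ 4` the supremum over `(θ, λ)` of the norm of its `k`-th derivative, whose
components are the partial derivatives `∂^{r+s} / ∂θ^r ∂λ^s` with `r + s = k`, has a finite
(outer) second moment under `(θ₀, η₀)`. Derivatives are taken at interior points. -/
def ConditionK2 (M : CondParamModel d 𝒴 𝒲) (θ₀ : EuclideanSpace ℝ (Fin d)) (η₀ : ℝ → ℝ) : Prop :=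
  (∀ᵐ x ∂(M.law θ₀ η₀), ∀ θ ∈ interior M.Θ, ∀ l ∈ interior M.H, 0 < M.lik x θ l) ∧
  (∀ᵐ x ∂(M.law θ₀ η₀), ContDiffOn ℝ 4
    (fun p : EuclideanSpace ℝ (Fin d) × ℝ => M.loglik x p.1 p.2)
    (interior M.Θ ×ˢ interior M.H)) ∧
  ∀ k ≤ 4, ∃ A : 𝒴 × (𝒲 × unitInterval) → ℝ, MemLp A 2 (M.law θ₀ η₀) ∧
    ∀ᵐ x ∂(M.law θ₀ η₀), ∀ θ ∈ interior M.Θ, ∀ l ∈ interior M.H,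
      ‖iteratedFDeriv ℝ k
        (fun p : EuclideanSpace ℝ (Fin d) × ℝ => M.loglik x p.1 p.2) (θ, l)‖ ≤ A x

/-- The least favorable curve at `θ`: `ηs` belongs to the nuisance space and maximizes
`E[log lik(X; θ, η(Z)) | Z]` over it, the expectation being taken under `(θ₀, η₀)`. -/
def IsLeastFavorableAt (M : CondParamModel d 𝒴 𝒲) (θ₀ : EuclideanSpace ℝ (Fin d)) (η₀ : ℝ → ℝ)
    (θ : EuclideanSpace ℝ (Fin d)) (ηs : ℝ → ℝ) : Prop :=
  ηs ∈ M.nuisanceSpace ∧ ∀ η ∈ M.nuisanceSpace,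
    condExp (MeasurableSpace.comap (fun x : 𝒴 × (𝒲 × unitInterval) => x.2.2) inferInstance)
        (M.law θ₀ η₀) (fun x => M.loglik x θ (η x.2.2))
      ≤ᵐ[M.law θ₀ η₀]
    condExp (MeasurableSpace.comap (fun x : 𝒴 × (𝒲 × unitInterval) => x.2.2) inferInstance)
        (M.law θ₀ η₀) (fun x => M.loglik x θ (ηs x.2.2))

/-- The kernel estimate at `θ` from the observations `x 0, …, x (n-1)` with kernel `K` and
bandwidth `b`: `ηh` belongs to the nuisance space and, for every `z ∈ [0,1]`, the number `ηh z`
maximizes `∑ log lik(xᵢ; θ, λ) K((z - zᵢ) / b)` over `λ` in the interior of `H`. -/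
def IsKernelEstimateAt (M : CondParamModel d 𝒴 𝒲) (K : ℝ → ℝ) (b : ℝ) (n : ℕ)
    (x : ℕ → 𝒴 × (𝒲 × unitInterval)) (θ : EuclideanSpace ℝ (Fin d)) (ηh : ℝ → ℝ) : Prop :=
  ηh ∈ M.nuisanceSpace ∧ ∀ z ∈ Icc (0 : ℝ) 1, ∀ l ∈ interior M.H,
    ∑ i ∈ Finset.range n, M.loglik (x i) θ l * K ((z - (x i).2.2) / b) ≤
      ∑ i ∈ Finset.range n, M.loglik (x i) θ (ηh z) * K ((z - (x i).2.2) / b)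

/-- The log-likelihood `∑ log lik(xᵢ; θ, η(θ)(zᵢ))` of the first `n` observations along a curve
`θ ↦ η(θ)`. -/
def profile (M : CondParamModel d 𝒴 𝒲) (n : ℕ) (x : ℕ → 𝒴 × (𝒲 × unitInterval))
    (η : EuclideanSpace ℝ (Fin d) → ℝ → ℝ) (θ : EuclideanSpace ℝ (Fin d)) : ℝ :=
  ∑ i ∈ Finset.range n, M.loglik (x i) θ (η θ (x i).2.2)

end CondParamModel

/-- A kernel: an integrable function of total integral one. -/
def IsKernel (K : ℝ → ℝ) : Prop := Integrable K ∧ ∫ u, K u = 1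

/-- Smoothness of the curve `ηs` and of its estimate `ηh` on a neighborhood `N` of `θ₀`. -/
def ConditionC1 {d : ℕ} {Ω : Type*} [MeasurableSpace Ω] (μ : Measure Ω)
    (ηs : EuclideanSpace ℝ (Fin d) → ℝ → ℝ)
    (ηh : ℕ → Ω → EuclideanSpace ℝ (Fin d) → ℝ → ℝ)
    (N : Set (EuclideanSpace ℝ (Fin d))) : Prop :=
  MixedDerivsExist ηs N ∧
  WithProbTendingToOne μ (fun n ω => MixedDerivsExist (ηh n ω) N) ∧
  ∀ s ≤ 3, ∃ C : ℝ, ∀ θ ∈ N, ∀ z ∈ Icc (0 : ℝ) 1, ‖thetaDeriv ηs s θ z‖ ≤ C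

/-- Uniform convergence rates of the estimate `ηh` of the curve `ηs`. -/
def ConditionC2 {d : ℕ} {Ω : Type*} [MeasurableSpace Ω] (μ : Measure Ω)
    (ηs : EuclideanSpace ℝ (Fin d) → ℝ → ℝ)
    (ηh : ℕ → Ω → EuclideanSpace ℝ (Fin d) → ℝ → ℝ)
    (θ₀ : EuclideanSpace ℝ (Fin d)) (N : Set (EuclideanSpace ℝ (Fin d))) (g δ : ℝ) : Prop :=
  (1 / 4 < g ∧ g ≤ 1 / 2) ∧ (2 * g - 1 / 2 ≤ δ ∧ δ ≤ g) ∧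
  (∀ s ≤ 2, BigOP μ
    (fun n ω => ⨆ θ ∈ N, ⨆ z ∈ Icc (0 : ℝ) 1,
      ‖thetaDeriv (ηh n ω) s θ z - thetaDeriv ηs s θ z‖ₑ)
    (fun n => (n : ℝ) ^ (-g))) ∧
  LittleOP μ
    (fun n ω => ⨆ θ ∈ N, ⨆ z ∈ Icc (0 : ℝ) 1,
      ‖thetaDeriv (ηh n ω) 3 θ z - thetaDeriv ηs 3 θ z‖ₑ)
    (fun _ => 1) ∧
  (∀ s ≤ 1, LittleOP μ
    (fun n ω => ⨆ z ∈ Icc (0 : ℝ) 1,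
      ‖derivWithin (fun u => thetaDeriv (ηh n ω) s θ₀ u) (Icc 0 1) z -
        derivWithin (fun u => thetaDeriv ηs s θ₀ u) (Icc 0 1) z‖ₑ)
    (fun n => (n : ℝ) ^ (-δ)))

/-- The general condition on the criterion functions `Sh n` (based on the estimated curve) and
`S n` (based on the least favorable curve) with the neighborhood `N` of `θ₀` and the exponent `g`;
the derivatives that occur in it exist on `N`, with probability tending to one. -/
def ConditionG {d : ℕ} {Ω : Type*} [MeasurableSpace Ω] (μ : Measure Ω)
    (Sh S : ℕ → Ω → EuclideanSpace ℝ (Fin d) → ℝ)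
    (θ₀ : EuclideanSpace ℝ (Fin d)) (N : Set (EuclideanSpace ℝ (Fin d))) (g : ℝ) : Prop :=
  (1 / 4 < g ∧ g ≤ 1 / 2) ∧
  WithProbTendingToOne μ
    (fun n ω => ThriceDifferentiableOn (Sh n ω) N ∧ ThriceDifferentiableOn (S n ω) N) ∧
  BigOP μ
    (fun n ω => ‖(1 / n : ℝ) • iteratedFDeriv ℝ 1 (Sh n ω) θ₀ -
      (1 / n : ℝ) • iteratedFDeriv ℝ 1 (S n ω) θ₀‖ₑ)
    (fun n => (n : ℝ) ^ (-(2 * g))) ∧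
  BigOP μ
    (fun n ω => ⨆ θ ∈ N, ‖(1 / n : ℝ) • iteratedFDeriv ℝ 2 (Sh n ω) θ -
      (1 / n : ℝ) • iteratedFDeriv ℝ 2 (S n ω) θ‖ₑ)
    (fun n => (n : ℝ) ^ (-g)) ∧
  BigOP μ
    (fun n ω => ⨆ θ ∈ N, ‖(1 / n : ℝ) • iteratedFDeriv ℝ 3 (Sh n ω) θ‖ₑ)
    (fun _ => 1)

end

/-! Along a curve, the log-likelihood of one observation is the composition of `(θ, λ) ↦ log lik(x;
θ, λ)` with the graph map `θ ↦ (θ, η(θ)(z))`. All derivatives of the outer function up to order four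
are bounded by one square integrable envelope `A x`, and averages of `|A|` are `O_P(1)`. The chain
rule then settles orders two and three. The second derivative depends on the value and first two
derivatives of the curve in a Lipschitz way, with constant a multiple of `A x`, so the difference
inherits the rate `n^{-g}`. The third derivative is at most `A x` times a polynomial in the
derivatives of the curve.

At order one a Lipschitz bound would only give `n^{-g}`. Expand the first derivative at `θ₀` in
direction `e` to first order in the error of the curve. The remainder is quadratic, at most a
multiple of `A x n^{-2g}`. The linear part is `a (∂_e η̂ - ∂_e η_*) + m (η̂ - η_*)`, where `a` is
the score in `λ` at the least favourable curve and `m` is the derivative of that score along the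
curve in direction `e`. Both weights are orthogonal to functions of `Z`: for `a` this is the first
order condition of the maximization (`IsLeastFavorableAt.integral_score_mul_eq_zero`), and for `m`
it is the `θ`-derivative of that condition (`integral_score_deriv_mul_eq_zero`).

The errors `η̂ - η_*` depend on the sample, so a bound uniform over a function class is needed.
Writing `f z = f 0 + ∫ 1{u ≤ z} f' u du` bounds a weighted sum over a ball of `C¹[0,1]` by its
radius times a plain sum and an integral over `u` of sums against step functions. These are centred
i.i.d. sums, so the variance formula and Tonelli give `n^{-1/2}` after averaging, with no entropy
argument (`exists_bigOP_forall_enorm_sum_mul_le`). The errors lie in a `C¹` ball of radius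
`O_P(n^{-δ})`, and `n^{-δ-1/2} ≤ n^{-2g}` because `δ ≥ 2g - 1/2`.

The expansions integrate along the segment from `η_*` to `η̂`, which must stay in the interior of
`H`. When `H` is not an interval, this is arranged by shrinking the neighbourhood and using uniform
closeness of the curves (`exists_isOpen_forall_segment_subset`). -/

noncomputable section

/-! ### Calculus of stochastic orders in outer probability. -/

section StochasticOrder

variable {Ω : Type*} [MeasurableSpace Ω] {μ : Measure Ω}

theorem WithProbTendingToOne.eventually_le {G : ℕ → Ω → Prop} (h : WithProbTendingToOne μ G)
    {ε : ℝ≥0∞} (hε : 0 < ε) : ∀ᶠ n in atTop, μ {ω | ¬ G n ω} ≤ ε :=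
  (h.eventually_lt_const hε).mono fun _ hn => hn.le

theorem WithProbTendingToOne.and {G G' : ℕ → Ω → Prop} (h : WithProbTendingToOne μ G)
    (h' : WithProbTendingToOne μ G') : WithProbTendingToOne μ fun n ω => G n ω ∧ G' n ω := by
  have h0 : Tendsto (fun n => μ {ω | ¬ G n ω} + μ {ω | ¬ G' n ω}) atTop (𝓝 0) := by
    simpa using Tendsto.add h h'
  refine tendsto_of_tendsto_of_tendsto_of_le_of_le tendsto_const_nhds h0 (fun _ => zero_le) ?_
  intro n
  refine (measure_mono ?_).trans (measure_union_le _ _)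
  intro ω hω
  by_cases h1 : G n ω
  · exact Or.inr fun h2 => hω ⟨h1, h2⟩
  · exact Or.inl h1

theorem WithProbTendingToOne.mono_ae {G G' : ℕ → Ω → Prop} (h : WithProbTendingToOne μ G)
    (hG : ∀ᶠ n in atTop, ∀ᵐ ω ∂μ, G n ω → G' n ω) : WithProbTendingToOne μ G' := by
  refine tendsto_of_tendsto_of_tendsto_of_le_of_le' tendsto_const_nhds h
    (Eventually.of_forall fun _ => zero_le) ?_
  filter_upwards [hG] with n hn
  refine measure_mono_ae ?_
  filter_upwards [hn] with ω hω h1 h2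
  exact h1 (hω h2)

theorem withProbTendingToOne_of_ae {G : ℕ → Ω → Prop}
    (hG : ∀ᵐ ω ∂μ, ∀ n, G n ω) : WithProbTendingToOne μ G := by
  have : ∀ n, μ {ω | ¬ G n ω} = 0 := fun n => by
    have := ae_all_iff.1 hG n
    exact this
  simp only [WithProbTendingToOne, this]
  exact tendsto_const_nhds

theorem LittleOP.bigOP {R : ℕ → Ω → ℝ≥0∞} {r : ℕ → ℝ} (h : LittleOP μ R r) : BigOP μ R r := by
  intro ε hε
  exact ⟨1, ((h 1 one_pos).eventually_lt_const (ENNReal.ofReal_pos.2 hε)).mono fun _ hn => hn.le⟩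

/-- If `R' n = O_P(r' n)` follows deterministically from bounds on finitely many sequences of known
stochastic order, on an event of probability tending to one, then it holds. -/
theorem BigOP.of_forall {ι : Type*} [Fintype ι] {R : ι → ℕ → Ω → ℝ≥0∞} {r : ι → ℕ → ℝ}
    (hr : ∀ j n, 0 ≤ r j n) (h : ∀ j, BigOP μ (R j) (r j)) {G : ℕ → Ω → Prop}
    (hG : WithProbTendingToOne μ G) {R' : ℕ → Ω → ℝ≥0∞} {r' : ℕ → ℝ}
    (H : ∀ M : ℝ, 0 ≤ M → ∃ M' : ℝ, ∀ᶠ n in atTop, ∀ ω, G n ω →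
      (∀ j, R j n ω ≤ ENNReal.ofReal (M * r j n)) → R' n ω ≤ ENNReal.ofReal (M' * r' n)) :
    BigOP μ R' r' := by
  intro ε hε
  -- The error budget `ε` is split into one share for each sequence and one for the exceptional
  -- event.
  set k : ℝ := Fintype.card ι + 1 with hk
  have hkpos : 0 < k := by positivity
  choose M hM using fun j => h j (ε / k) (by positivity)
  -- A single nonnegative constant that dominates every `M j`.
  obtain ⟨M', hM'⟩ := H (∑ j, |M j|) (Finset.sum_nonneg fun _ _ => abs_nonneg _)
  refine ⟨M', ?_⟩
  filter_upwards [hM', eventually_all.2 hM,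
    hG.eventually_le (ENNReal.ofReal_pos.2 (div_pos hε hkpos))] with n h1 h2 h3
  have hsub : {ω | ENNReal.ofReal (M' * r' n) < R' n ω} ⊆
      {ω | ¬ G n ω} ∪
        ⋃ j ∈ (Finset.univ : Finset ι), {ω | ENNReal.ofReal (M j * r j n) < R j n ω} := by
    intro ω hω
    by_contra hcon
    simp only [mem_union, mem_ofPred_eq, not_or, not_not, mem_iUnion, Finset.mem_univ,
      exists_prop, true_and, not_exists, not_lt] at hcon hω
    refine absurd (h1 ω hcon.1 fun j => (hcon.2 j).trans (ENNReal.ofReal_le_ofReal ?_)) hω.not_ge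
    refine mul_le_mul_of_nonneg_right ((le_abs_self _).trans ?_) (hr j n)
    exact Finset.single_le_sum (f := fun j => |M j|) (fun _ _ => abs_nonneg _) (Finset.mem_univ j)
  calc μ {ω | ENNReal.ofReal (M' * r' n) < R' n ω}
      ≤ μ {ω | ¬ G n ω} +
        ∑ j, μ {ω | ENNReal.ofReal (M j * r j n) < R j n ω} :=
        (measure_mono hsub).trans ((measure_union_le _ _).trans
          (add_le_add le_rfl (measure_biUnion_finset_le _ _)))
    _ ≤ ENNReal.ofReal (ε / k) + ∑ _j : ι, ENNReal.ofReal (ε / k) :=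
        add_le_add h3 (Finset.sum_le_sum fun j _ => h2 j)
    _ = ENNReal.ofReal ε := by
        rw [← ENNReal.ofReal_sum_of_nonneg (fun _ _ => by positivity),
          ← ENNReal.ofReal_add (by positivity) (by positivity)]
        congr 1
        simp only [Finset.sum_const, Finset.card_univ, nsmul_eq_mul]
        field_simp
        rw [hk]; ring

/-- Markov's inequality. -/
theorem bigOP_of_lintegral_le {R : ℕ → Ω → ℝ≥0∞} {r : ℕ → ℝ} {C : ℝ}
    (hR : ∀ n, AEMeasurable (R n) μ) (hr : ∀ᶠ n in atTop, 0 < r n)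
    (h : ∀ᶠ n in atTop, ∫⁻ ω, R n ω ∂μ ≤ ENNReal.ofReal (C * r n)) : BigOP μ R r := by
  intro ε hε
  -- Adding one keeps the threshold strictly positive even when `C = 0`, so that it can be cancelled
  -- at the end.
  refine ⟨(|C| + 1) / ε, ?_⟩
  filter_upwards [hr, h] with n hn h1
  set a := (|C| + 1) / ε * r n with ha
  have hapos : 0 < a := by positivity
  have h2 := mul_meas_ge_le_lintegral₀ (hR n) (ENNReal.ofReal a)
  have h3 : ENNReal.ofReal a * μ {ω | ENNReal.ofReal a < R n ω} ≤
      ENNReal.ofReal a * ENNReal.ofReal ε := by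
    calc _ ≤ ENNReal.ofReal a * μ {ω | ENNReal.ofReal a ≤ R n ω} := by
          gcongr; exact fun h => le_of_lt h
      _ ≤ ENNReal.ofReal (C * r n) := h2.trans h1
      _ ≤ ENNReal.ofReal (a * ε) := by
          refine ENNReal.ofReal_le_ofReal ?_
          have : a * ε = (|C| + 1) * r n := by rw [ha]; field_simp
          rw [this]
          exact mul_le_mul_of_nonneg_right (by linarith [le_abs_self C]) hn.le
      _ = _ := ENNReal.ofReal_mul hapos.le
  exact (ENNReal.mul_le_mul_iff_right (by simpa using hapos) ENNReal.ofReal_ne_top).1 h3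

end StochasticOrder

/-! ### Three derivatives in curried form, and the chain rule. -/

section ThreeDerivatives

set_option maxSynthPendingDepth 3

variable {E G F : Type*} [NormedAddCommGroup E] [NormedSpace ℝ E] [NormedAddCommGroup G]
  [NormedSpace ℝ G] [NormedAddCommGroup F] [NormedSpace ℝ F]

/-- Differentiability of the iterated derivatives passes to the derivative. -/
theorem differentiableOn_iteratedFDeriv_succ_iff {f : E → F} {N : Set E} {k : ℕ} :
    DifferentiableOn ℝ (iteratedFDeriv ℝ (k + 1) f) N ↔
      DifferentiableOn ℝ (iteratedFDeriv ℝ k (fderiv ℝ f)) N := by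
  have : iteratedFDeriv ℝ (k + 1) f =
      ⇑(continuousMultilinearCurryRightEquiv' ℝ k E F).symm ∘ iteratedFDeriv ℝ k (fderiv ℝ f) := by
    funext x
    exact iteratedFDeriv_succ_eq_comp_right
  rw [this]
  exact LinearIsometryEquiv.comp_differentiableOn_iff _

theorem differentiableOn_iteratedFDeriv_zero_iff {f : E → F} {N : Set E} :
    DifferentiableOn ℝ (iteratedFDeriv ℝ 0 f) N ↔ DifferentiableOn ℝ f N := by
  have : iteratedFDeriv ℝ 0 f =
    ⇑(continuousMultilinearCurryFin0 ℝ E F).symm ∘ f := iteratedFDeriv_zero_eq_comp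
  rw [this]
  exact LinearIsometryEquiv.comp_differentiableOn_iff _

/-- `f₁`, `f₂`, `f₃` are the first three derivatives of `f` on `N`. -/
structure HasThreeFDerivOn (f : E → F) (f₁ : E → E →L[ℝ] F) (f₂ : E → E →L[ℝ] E →L[ℝ] F)
    (f₃ : E → E →L[ℝ] E →L[ℝ] E →L[ℝ] F) (N : Set E) : Prop where
  first : ∀ x ∈ N, HasFDerivAt f (f₁ x) x
  second : ∀ x ∈ N, HasFDerivAt f₁ (f₂ x) x
  third : ∀ x ∈ N, HasFDerivAt f₂ (f₃ x) x

namespace HasThreeFDerivOn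

variable {f : E → F} {f₁ : E → E →L[ℝ] F} {f₂ : E → E →L[ℝ] E →L[ℝ] F}
    {f₃ : E → E →L[ℝ] E →L[ℝ] E →L[ℝ] F} {N : Set E}

theorem sum {ι : Type*} {s : Finset ι} {f : ι → E → F} {f₁ : ι → E → E →L[ℝ] F}
    {f₂ : ι → E → E →L[ℝ] E →L[ℝ] F} {f₃ : ι → E → E →L[ℝ] E →L[ℝ] E →L[ℝ] F}
    (h : ∀ i ∈ s, HasThreeFDerivOn (f i) (f₁ i) (f₂ i) (f₃ i) N) :
    HasThreeFDerivOn (fun x => ∑ i ∈ s, f i x) (fun x => ∑ i ∈ s, f₁ i x)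
      (fun x => ∑ i ∈ s, f₂ i x) (fun x => ∑ i ∈ s, f₃ i x) N :=
  ⟨fun x hx => HasFDerivAt.fun_sum fun i hi => (h i hi).first x hx,
    fun x hx => HasFDerivAt.fun_sum fun i hi => (h i hi).second x hx,
    fun x hx => HasFDerivAt.fun_sum fun i hi => (h i hi).third x hx⟩

theorem fderiv_eq (h : HasThreeFDerivOn f f₁ f₂ f₃ N) {x : E} (hx : x ∈ N) :
    fderiv ℝ f x = f₁ x :=
  (h.first x hx).fderiv

theorem fderiv_fderiv_eq (h : HasThreeFDerivOn f f₁ f₂ f₃ N) (hN : IsOpen N) {x : E}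
    (hx : x ∈ N) : fderiv ℝ (fderiv ℝ f) x = f₂ x := by
  have : fderiv ℝ f =ᶠ[𝓝 x] f₁ := by
    filter_upwards [hN.mem_nhds hx] with y hy using h.fderiv_eq hy
  rw [this.fderiv_eq, (h.second x hx).fderiv]

theorem fderiv_fderiv_fderiv_eq (h : HasThreeFDerivOn f f₁ f₂ f₃ N) (hN : IsOpen N) {x : E}
    (hx : x ∈ N) : fderiv ℝ (fderiv ℝ (fderiv ℝ f)) x = f₃ x := by
  have : fderiv ℝ (fderiv ℝ f) =ᶠ[𝓝 x] f₂ := by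
    filter_upwards [hN.mem_nhds hx] with y hy using h.fderiv_fderiv_eq hN hy
  rw [this.fderiv_eq, (h.third x hx).fderiv]

theorem norm_iteratedFDeriv_three (h : HasThreeFDerivOn f f₁ f₂ f₃ N) (hN : IsOpen N) {x : E}
    (hx : x ∈ N) : ‖iteratedFDeriv ℝ 3 f x‖ = ‖f₃ x‖ := by
  rw [← norm_iteratedFDeriv_fderiv, ← norm_iteratedFDeriv_fderiv, ← norm_iteratedFDeriv_fderiv,
    norm_iteratedFDeriv_zero, h.fderiv_fderiv_fderiv_eq hN hx]

theorem norm_iteratedFDeriv_two (h : HasThreeFDerivOn f f₁ f₂ f₃ N) (hN : IsOpen N) {x : E}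
    (hx : x ∈ N) : ‖iteratedFDeriv ℝ 2 f x‖ = ‖f₂ x‖ := by
  rw [← norm_iteratedFDeriv_fderiv, ← norm_iteratedFDeriv_fderiv,
    norm_iteratedFDeriv_zero, h.fderiv_fderiv_eq hN hx]

theorem norm_iteratedFDeriv_one (h : HasThreeFDerivOn f f₁ f₂ f₃ N) {x : E}
    (hx : x ∈ N) : ‖iteratedFDeriv ℝ 1 f x‖ = ‖f₁ x‖ := by
  rw [← norm_iteratedFDeriv_fderiv, norm_iteratedFDeriv_zero, h.fderiv_eq hx]

theorem differentiableOn_iteratedFDeriv (h : HasThreeFDerivOn f f₁ f₂ f₃ N) (hN : IsOpen N)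
    {k : ℕ} (hk : k < 3) : DifferentiableOn ℝ (iteratedFDeriv ℝ k f) N := by
  interval_cases k
  · rw [differentiableOn_iteratedFDeriv_zero_iff]
    exact fun x hx => (h.first x hx).differentiableAt.differentiableWithinAt
  · rw [differentiableOn_iteratedFDeriv_succ_iff, differentiableOn_iteratedFDeriv_zero_iff]
    exact fun x hx => ((h.second x hx).differentiableAt.differentiableWithinAt).congr
      (fun y hy => h.fderiv_eq hy) (h.fderiv_eq hx)
  · rw [differentiableOn_iteratedFDeriv_succ_iff, differentiableOn_iteratedFDeriv_succ_iff,
      differentiableOn_iteratedFDeriv_zero_iff]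
    exact fun x hx => ((h.third x hx).differentiableAt.differentiableWithinAt).congr
      (fun y hy => h.fderiv_fderiv_eq hN hy) (h.fderiv_fderiv_eq hN hx)

end HasThreeFDerivOn

/-- The derivatives of a function with differentiable iterated derivatives. -/
theorem hasThreeFDerivOn_of_differentiableOn {f : E → F} {N : Set E} (hN : IsOpen N)
    (h : ∀ k < 3, DifferentiableOn ℝ (iteratedFDeriv ℝ k f) N) :
    HasThreeFDerivOn f (fderiv ℝ f) (fderiv ℝ (fderiv ℝ f))
      (fderiv ℝ (fderiv ℝ (fderiv ℝ f))) N := by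
  have h0 := differentiableOn_iteratedFDeriv_zero_iff.1 (h 0 (by norm_num))
  have h1 := differentiableOn_iteratedFDeriv_zero_iff.1
    (differentiableOn_iteratedFDeriv_succ_iff.1 (h 1 (by norm_num)))
  have h2 := differentiableOn_iteratedFDeriv_zero_iff.1
    (differentiableOn_iteratedFDeriv_succ_iff.1
      (differentiableOn_iteratedFDeriv_succ_iff.1 (h 2 (by norm_num))))
  exact ⟨fun x hx => (h0.differentiableAt (hN.mem_nhds hx)).hasFDerivAt,
    fun x hx => (h1.differentiableAt (hN.mem_nhds hx)).hasFDerivAt,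
    fun x hx => (h2.differentiableAt (hN.mem_nhds hx)).hasFDerivAt⟩

theorem ContDiffOn.hasThreeFDerivOn {f : E → F} {U : Set E} (hU : IsOpen U)
    (h : ContDiffOn ℝ 3 f U) :
    HasThreeFDerivOn f (fderiv ℝ f) (fderiv ℝ (fderiv ℝ f))
      (fderiv ℝ (fderiv ℝ (fderiv ℝ f))) U := by
  refine hasThreeFDerivOn_of_differentiableOn hU fun k hk x hx => ?_
  exact ((h.contDiffAt (hU.mem_nhds hx)).differentiableAt_iteratedFDeriv
    (by exact_mod_cast hk)).differentiableWithinAt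

/-- The assumptions on the curves are stated in norms of multilinear forms, while the chain rule
works with curried derivatives. Evaluating on vectors compares the two. -/
theorem norm_fderiv_sub_le_norm_iteratedFDeriv_one_sub (f g : E → F) (x : E) :
    ‖fderiv ℝ f x - fderiv ℝ g x‖ ≤ ‖iteratedFDeriv ℝ 1 f x - iteratedFDeriv ℝ 1 g x‖ := by
  refine ContinuousLinearMap.opNorm_le_bound _ (norm_nonneg _) fun u => ?_
  have := (iteratedFDeriv ℝ 1 f x - iteratedFDeriv ℝ 1 g x).le_opNorm (fun _ => u)
  simpa [iteratedFDeriv_one_apply] using this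

theorem norm_fderiv_fderiv_sub_le_norm_iteratedFDeriv_two_sub (f g : E → F) (x : E) :
    ‖fderiv ℝ (fderiv ℝ f) x - fderiv ℝ (fderiv ℝ g) x‖ ≤
      ‖iteratedFDeriv ℝ 2 f x - iteratedFDeriv ℝ 2 g x‖ := by
  refine ContinuousLinearMap.opNorm_le_bound₂ _ (norm_nonneg _) fun u v => ?_
  have := (iteratedFDeriv ℝ 2 f x - iteratedFDeriv ℝ 2 g x).le_opNorm ![u, v]
  simpa [iteratedFDeriv_two_apply, mul_assoc] using this

theorem norm_smul_iteratedFDeriv_two_sub_le (f g : E → F) (c : ℝ) (x : E) :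
    ‖c • iteratedFDeriv ℝ 2 f x - c • iteratedFDeriv ℝ 2 g x‖ ≤
      |c| * ‖fderiv ℝ (fderiv ℝ f) x - fderiv ℝ (fderiv ℝ g) x‖ := by
  rw [← smul_sub, norm_smul, Real.norm_eq_abs]
  refine mul_le_mul_of_nonneg_left ?_ (abs_nonneg _)
  refine ContinuousMultilinearMap.opNorm_le_bound (norm_nonneg _) fun m => ?_
  have := (fderiv ℝ (fderiv ℝ f) x - fderiv ℝ (fderiv ℝ g) x).le_opNorm₂ (m 0) (m 1)
  simpa [iteratedFDeriv_two_apply, mul_assoc] using this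

section Composition

/-- The second derivative of a composition, in terms of the derivatives `A`, `B` of the outer
function and `a`, `b` of the inner one. -/
def secondFDerivComp (A : G →L[ℝ] F) (B : G →L[ℝ] G →L[ℝ] F) (a : E →L[ℝ] G)
    (b : E →L[ℝ] E →L[ℝ] G) : E →L[ℝ] E →L[ℝ] F :=
  (ContinuousLinearMap.compL ℝ E G F A).comp b +
    ((ContinuousLinearMap.compL ℝ E G F).flip a).comp (B.comp a)

theorem secondFDerivComp_apply (A : G →L[ℝ] F) (B : G →L[ℝ] G →L[ℝ] F) (a : E →L[ℝ] G)
    (b : E →L[ℝ] E →L[ℝ] G) (u v : E) :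
    secondFDerivComp A B a b u v = A (b u v) + B (a u) (a v) := rfl

/-- The product rule with its derivative hidden behind a norm bound. Third derivatives of
compositions can then be estimated without being written out. -/
theorem HasFDerivAt.clm_comp_norm_le {H : Type*} [NormedAddCommGroup H] [NormedSpace ℝ H]
    {K : Type*} [NormedAddCommGroup K] [NormedSpace ℝ K]
    {c : E → G →L[ℝ] H} {c' : E →L[ℝ] G →L[ℝ] H} {d : E → K →L[ℝ] G} {d' : E →L[ℝ] K →L[ℝ] G}
    {x : E} (hc : HasFDerivAt c c' x) (hd : HasFDerivAt d d' x) :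
    ∃ L : E →L[ℝ] K →L[ℝ] H, HasFDerivAt (fun y => (c y).comp (d y)) L x ∧
      ‖L‖ ≤ ‖c x‖ * ‖d'‖ + ‖c'‖ * ‖d x‖ := by
  refine ⟨_, hc.clm_comp hd, (norm_add_le _ _).trans (add_le_add ?_ ?_)⟩
  · refine ContinuousLinearMap.opNorm_le_bound₂ _ (by positivity) fun u v => ?_
    calc ‖c x (d' u v)‖ ≤ ‖c x‖ * (‖d'‖ * ‖u‖ * ‖v‖) :=
          (c x).le_opNorm_of_le (d'.le_opNorm₂ u v)
      _ = _ := by ring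
  · refine ContinuousLinearMap.opNorm_le_bound₂ _ (by positivity) fun u v => ?_
    calc ‖c' u (d x v)‖ ≤ ‖c'‖ * ‖u‖ * (‖d x‖ * ‖v‖) :=
          (c'.le_opNorm₂ _ _).trans (by gcongr; exact (d x).le_opNorm v)
      _ = _ := by ring

/-- The chain rule up to order three, with a bound for the third derivative. -/
theorem HasThreeFDerivOn.comp {f : G → F} {F₁ : G → G →L[ℝ] F} {F₂ : G → G →L[ℝ] G →L[ℝ] F}
    {F₃ : G → G →L[ℝ] G →L[ℝ] G →L[ℝ] F} {U : Set G}
    {p : E → G} {p₁ : E → E →L[ℝ] G} {p₂ : E → E →L[ℝ] E →L[ℝ] G}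
    {p₃ : E → E →L[ℝ] E →L[ℝ] E →L[ℝ] G} {N : Set E}
    (hf : HasThreeFDerivOn f F₁ F₂ F₃ U) (hp : HasThreeFDerivOn p p₁ p₂ p₃ N)
    (hpU : MapsTo p N U) :
    ∃ f₃ : E → E →L[ℝ] E →L[ℝ] E →L[ℝ] F,
      HasThreeFDerivOn (fun x => f (p x)) (fun x => (F₁ (p x)).comp (p₁ x))
        (fun x => secondFDerivComp (F₁ (p x)) (F₂ (p x)) (p₁ x) (p₂ x)) f₃ N ∧
      ∀ x ∈ N, ‖f₃ x‖ ≤ ‖F₃ (p x)‖ * ‖p₁ x‖ ^ 3 + 3 * ‖F₂ (p x)‖ * ‖p₁ x‖ * ‖p₂ x‖ +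
        ‖F₁ (p x)‖ * ‖p₃ x‖ := by
  -- The membership `x ∈ N` sits inside the existential so that `choose` yields a function on all of
  -- `E`; its value off `N` is irrelevant.
  have key : ∀ x : E, ∃ L : E →L[ℝ] E →L[ℝ] E →L[ℝ] F, x ∈ N →
      HasFDerivAt (fun x => secondFDerivComp (F₁ (p x)) (F₂ (p x)) (p₁ x) (p₂ x)) L x ∧
      ‖L‖ ≤ ‖F₃ (p x)‖ * ‖p₁ x‖ ^ 3 + 3 * ‖F₂ (p x)‖ * ‖p₁ x‖ * ‖p₂ x‖ +
        ‖F₁ (p x)‖ * ‖p₃ x‖ := by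
    intro x
    by_cases hx : x ∈ N
    swap
    · exact ⟨0, fun h => absurd h hx⟩
    have hA : HasFDerivAt (fun x => F₁ (p x)) ((F₂ (p x)).comp (p₁ x)) x :=
      (hf.second _ (hpU hx)).comp x (hp.first x hx)
    have hB : HasFDerivAt (fun x => F₂ (p x)) ((F₃ (p x)).comp (p₁ x)) x :=
      (hf.third _ (hpU hx)).comp x (hp.first x hx)
    -- The second derivative is `A ∘ b` plus `B` applied to `a` twice. `L₁` differentiates the first
    -- summand, `L₂` the inner factor `B ∘ a`, and `L₃` the whole second summand. The term `‖F₂‖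
    -- ‖p₁‖ ‖p₂‖` occurs once in `L₁` and twice in `L₃`, which explains the factor 3.
    have hcA := (ContinuousLinearMap.compL ℝ E G F).hasFDerivAt.comp x hA
    obtain ⟨L₁, hL₁, hL₁n⟩ := hcA.clm_comp_norm_le (hp.third x hx)
    have hca := (ContinuousLinearMap.compL ℝ E G F).flip.hasFDerivAt.comp x (hp.second x hx)
    obtain ⟨L₂, hL₂, hL₂n⟩ := hB.clm_comp_norm_le (hp.second x hx)
    obtain ⟨L₃, hL₃, hL₃n⟩ := hca.clm_comp_norm_le hL₂
    refine ⟨L₁ + L₃, fun _ => ⟨hL₁.add hL₃, ?_⟩⟩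
    have b1 : ‖(ContinuousLinearMap.compL ℝ E G F) (F₁ (p x))‖ ≤ ‖F₁ (p x)‖ := by
      refine (ContinuousLinearMap.le_opNorm _ _).trans ?_
      exact mul_le_of_le_one_left (norm_nonneg _) (ContinuousLinearMap.norm_compL_le _ _ _ _)
    have b2 : ‖(ContinuousLinearMap.compL ℝ E G F).comp ((F₂ (p x)).comp (p₁ x))‖ ≤
        ‖F₂ (p x)‖ * ‖p₁ x‖ := by
      refine (ContinuousLinearMap.opNorm_comp_le _ _).trans ?_
      exact (mul_le_of_le_one_left (norm_nonneg _)
        (ContinuousLinearMap.norm_compL_le _ _ _ _)).trans (ContinuousLinearMap.opNorm_comp_le _ _)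
    have b3 : ‖(ContinuousLinearMap.compL ℝ E G F).flip (p₁ x)‖ ≤ ‖p₁ x‖ := by
      refine (ContinuousLinearMap.le_opNorm _ _).trans ?_
      rw [ContinuousLinearMap.opNorm_flip]
      exact mul_le_of_le_one_left (norm_nonneg _) (ContinuousLinearMap.norm_compL_le _ _ _ _)
    have b4 : ‖(ContinuousLinearMap.compL ℝ E G F).flip.comp (p₂ x)‖ ≤ ‖p₂ x‖ := by
      refine (ContinuousLinearMap.opNorm_comp_le _ _).trans ?_
      rw [ContinuousLinearMap.opNorm_flip]
      exact mul_le_of_le_one_left (norm_nonneg _) (ContinuousLinearMap.norm_compL_le _ _ _ _)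
    have b5 : ‖(F₃ (p x)).comp (p₁ x)‖ ≤ ‖F₃ (p x)‖ * ‖p₁ x‖ :=
      ContinuousLinearMap.opNorm_comp_le _ _
    have b6 : ‖(F₂ (p x)).comp (p₁ x)‖ ≤ ‖F₂ (p x)‖ * ‖p₁ x‖ :=
      ContinuousLinearMap.opNorm_comp_le _ _
    have c1 : ‖L₁‖ ≤ ‖F₁ (p x)‖ * ‖p₃ x‖ + ‖F₂ (p x)‖ * ‖p₁ x‖ * ‖p₂ x‖ :=
      hL₁n.trans (add_le_add (mul_le_mul_of_nonneg_right b1 (norm_nonneg _))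
        (mul_le_mul_of_nonneg_right b2 (norm_nonneg _)))
    have c2 : ‖L₂‖ ≤ ‖F₂ (p x)‖ * ‖p₂ x‖ + ‖F₃ (p x)‖ * ‖p₁ x‖ * ‖p₁ x‖ :=
      hL₂n.trans (add_le_add le_rfl (mul_le_mul_of_nonneg_right b5 (norm_nonneg _)))
    have c3 : ‖L₃‖ ≤ ‖p₁ x‖ * (‖F₂ (p x)‖ * ‖p₂ x‖ + ‖F₃ (p x)‖ * ‖p₁ x‖ * ‖p₁ x‖) +
        ‖p₂ x‖ * (‖F₂ (p x)‖ * ‖p₁ x‖) :=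
      hL₃n.trans (add_le_add (mul_le_mul b3 c2 (norm_nonneg _) (norm_nonneg _))
        (mul_le_mul b4 b6 (norm_nonneg _) (norm_nonneg _)))
    refine (norm_add_le _ _).trans ((add_le_add c1 c3).trans (le_of_eq ?_))
    ring
  choose f₃ hf₃ using key
  refine ⟨f₃, ⟨fun x hx => (hf.first _ (hpU hx)).comp x (hp.first x hx), fun x hx => ?_,
    fun x hx => (hf₃ x hx).1⟩, fun x hx => (hf₃ x hx).2⟩
  exact ((hf.second _ (hpU hx)).comp x (hp.first x hx)).clm_comp (hp.second x hx)

/-- Dependence of the second derivative of a composition on its ingredients. -/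
theorem norm_secondFDerivComp_sub_le (A A' : G →L[ℝ] F) (B B' : G →L[ℝ] G →L[ℝ] F)
    (a a' : E →L[ℝ] G) (b b' : E →L[ℝ] E →L[ℝ] G) :
    ‖secondFDerivComp A' B' a' b' - secondFDerivComp A B a b‖ ≤
      ‖A' - A‖ * ‖b'‖ + ‖A‖ * ‖b' - b‖ +
        (‖B' - B‖ * ‖a'‖ * ‖a'‖ + ‖B‖ * ‖a' - a‖ * ‖a'‖ + ‖B‖ * ‖a‖ * ‖a' - a‖) := by
  refine ContinuousLinearMap.opNorm_le_bound₂ _ (by positivity) fun u v => ?_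
  -- Telescoping: one ingredient is replaced at a time.
  have e : (secondFDerivComp A' B' a' b' - secondFDerivComp A B a b) u v =
      (A' - A) (b' u v) + A ((b' - b) u v) +
        ((B' - B) (a' u) (a' v) + B ((a' - a) u) (a' v) + B (a u) ((a' - a) v)) := by
    simp only [sub_apply, secondFDerivComp_apply, map_sub]
    abel
  rw [e]
  have h1 : ‖(A' - A) (b' u v)‖ ≤ ‖A' - A‖ * (‖b'‖ * ‖u‖ * ‖v‖) :=
    ContinuousLinearMap.le_opNorm_of_le _ (b'.le_opNorm₂ u v)
  have h2 : ‖A ((b' - b) u v)‖ ≤ ‖A‖ * (‖b' - b‖ * ‖u‖ * ‖v‖) :=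
    ContinuousLinearMap.le_opNorm_of_le _ ((b' - b).le_opNorm₂ u v)
  have h3 : ∀ (C : G →L[ℝ] G →L[ℝ] F) (s t : E →L[ℝ] G),
      ‖C (s u) (t v)‖ ≤ ‖C‖ * (‖s‖ * ‖u‖) * (‖t‖ * ‖v‖) := fun C s t =>
    (C.le_opNorm₂ _ _).trans (by gcongr <;> exact ContinuousLinearMap.le_opNorm _ _)
  refine (norm_add_le _ _).trans ((add_le_add ((norm_add_le _ _).trans (add_le_add h1 h2))
    ((norm_add_le _ _).trans (add_le_add ((norm_add_le _ _).trans
      (add_le_add (h3 _ _ _) (h3 _ _ _))) (h3 _ _ _)))).trans (le_of_eq ?_))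
  ring

end Composition

end ThreeDerivatives

/-! ### Functions composed with the graph of a curve. -/

section GraphComposition

set_option maxSynthPendingDepth 3

variable {E : Type*} [NormedAddCommGroup E] [NormedSpace ℝ E]

/-- Postcomposition with `l ↦ (0, l)`. -/
def inrComp (E : Type*) [NormedAddCommGroup E] [NormedSpace ℝ E] :
    (E →L[ℝ] ℝ) →L[ℝ] E →L[ℝ] E × ℝ :=
  ContinuousLinearMap.compL ℝ E ℝ (E × ℝ) (ContinuousLinearMap.inr ℝ E ℝ)

theorem inrComp_apply (l : E →L[ℝ] ℝ) (u : E) : inrComp E l u = (0, l u) := rfl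

theorem norm_inrComp_comp_le {K : Type*} [NormedAddCommGroup K] [NormedSpace ℝ K]
    (T : K →L[ℝ] E →L[ℝ] ℝ) : ‖(inrComp E).comp T‖ ≤ ‖T‖ := by
  refine ContinuousLinearMap.opNorm_le_bound₂ _ (norm_nonneg _) fun u v => ?_
  change ‖((0 : E), T u v)‖ ≤ _
  rw [Prod.norm_def, norm_zero, max_eq_right (norm_nonneg _)]
  exact T.le_opNorm₂ u v

theorem norm_prod_id_le (l : E →L[ℝ] ℝ) : ‖(ContinuousLinearMap.id ℝ E).prod l‖ ≤ 1 + ‖l‖ := by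
  refine ContinuousLinearMap.opNorm_le_bound _ (by positivity) fun u => ?_
  refine max_le ?_ ((l.le_opNorm u).trans ?_)
  · change ‖u‖ ≤ _
    nlinarith [mul_nonneg (norm_nonneg l) (norm_nonneg u)]
  · nlinarith [norm_nonneg u]

theorem norm_prod_id_sub_le (l l' : E →L[ℝ] ℝ) :
    ‖(ContinuousLinearMap.id ℝ E).prod l' - (ContinuousLinearMap.id ℝ E).prod l‖ ≤ ‖l' - l‖ := by
  refine ContinuousLinearMap.opNorm_le_bound _ (by positivity) fun u => ?_
  have : ((ContinuousLinearMap.id ℝ E).prod l' - (ContinuousLinearMap.id ℝ E).prod l) u =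
      (0, (l' - l) u) := by simp
  rw [this, Prod.norm_def, norm_zero, max_eq_right (norm_nonneg _)]
  exact (l' - l).le_opNorm u

/-- Postcomposition with `l ↦ (0, l)` for bilinear forms. -/
def inrComp₂ (E : Type*) [NormedAddCommGroup E] [NormedSpace ℝ E] :
    (E →L[ℝ] E →L[ℝ] ℝ) →L[ℝ] E →L[ℝ] E →L[ℝ] E × ℝ :=
  ContinuousLinearMap.compL ℝ E (E →L[ℝ] ℝ) (E →L[ℝ] E × ℝ) (inrComp E)

theorem norm_inrComp₂_comp_le (T : E →L[ℝ] E →L[ℝ] E →L[ℝ] ℝ) :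
    ‖(inrComp₂ E).comp T‖ ≤ ‖T‖ := by
  refine ContinuousLinearMap.opNorm_le_bound _ (norm_nonneg _) fun u => ?_
  exact (norm_inrComp_comp_le (T u)).trans (T.le_opNorm u)

/-- The derivative of `x ↦ (x, q x)` is the constant `inl` plus a linear image of `q₁`. Hence only
the second component contributes from order two on. -/
theorem HasThreeFDerivOn.graph {q : E → ℝ} {q₁ : E → E →L[ℝ] ℝ} {q₂ : E → E →L[ℝ] E →L[ℝ] ℝ}
    {q₃ : E → E →L[ℝ] E →L[ℝ] E →L[ℝ] ℝ} {N : Set E} (h : HasThreeFDerivOn q q₁ q₂ q₃ N) :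
    HasThreeFDerivOn (fun x => (x, q x)) (fun x => (ContinuousLinearMap.id ℝ E).prod (q₁ x))
      (fun x => (inrComp E).comp (q₂ x)) (fun x => (inrComp₂ E).comp (q₃ x)) N := by
  refine ⟨fun x hx => (hasFDerivAt_id x).prodMk (h.first x hx), fun x hx => ?_, fun x hx => ?_⟩
  · have e : (fun x => (ContinuousLinearMap.id ℝ E).prod (q₁ x)) =
        fun x => ContinuousLinearMap.inl ℝ E ℝ + inrComp E (q₁ x) := by
      funext y
      ext u <;> simp [inrComp_apply]
    rw [e]
    exact ((inrComp E).hasFDerivAt.comp x (h.second x hx)).const_add _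
  · exact (inrComp₂ E).hasFDerivAt.comp x (h.third x hx)

variable {f : E × ℝ → ℝ} {F₁ : E × ℝ → E × ℝ →L[ℝ] ℝ}
  {F₂ : E × ℝ → E × ℝ →L[ℝ] E × ℝ →L[ℝ] ℝ}
  {F₃ : E × ℝ → E × ℝ →L[ℝ] E × ℝ →L[ℝ] E × ℝ →L[ℝ] ℝ} {U : Set (E × ℝ)} {A : ℝ}

theorem norm_mk_sub_mk_left {V : Type*} [NormedAddCommGroup V] (x : V) (a b : ℝ) :
    ‖((x, b) : V × ℝ) - (x, a)‖ = |b - a| := by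
  rw [Prod.mk_sub_mk, sub_self, Prod.norm_def, norm_zero, max_eq_right (norm_nonneg _),
    Real.norm_eq_abs]

theorem HasThreeFDerivOn.norm_first_sub_le (hf : HasThreeFDerivOn f F₁ F₂ F₃ U)
    (hA : ∀ p ∈ U, ‖F₂ p‖ ≤ A) {x : E} {a b : ℝ}
    (hseg : segment ℝ ((x, a) : E × ℝ) (x, b) ⊆ U) : ‖F₁ (x, b) - F₁ (x, a)‖ ≤ A * |b - a| := by
  rw [← norm_mk_sub_mk_left x a b]
  exact (convex_segment _ _).norm_image_sub_le_of_norm_hasFDerivWithin_le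
    (fun p hp => (hf.second p (hseg hp)).hasFDerivWithinAt) (fun p hp => hA p (hseg hp))
    (left_mem_segment ℝ _ _) (right_mem_segment ℝ _ _)

theorem HasThreeFDerivOn.norm_second_sub_le (hf : HasThreeFDerivOn f F₁ F₂ F₃ U)
    (hA : ∀ p ∈ U, ‖F₃ p‖ ≤ A) {x : E} {a b : ℝ}
    (hseg : segment ℝ ((x, a) : E × ℝ) (x, b) ⊆ U) : ‖F₂ (x, b) - F₂ (x, a)‖ ≤ A * |b - a| := by
  rw [← norm_mk_sub_mk_left x a b]
  exact (convex_segment _ _).norm_image_sub_le_of_norm_hasFDerivWithin_le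
    (fun p hp => (hf.third p (hseg hp)).hasFDerivWithinAt) (fun p hp => hA p (hseg hp))
    (left_mem_segment ℝ _ _) (right_mem_segment ℝ _ _)

/-- Two applications of the mean value inequality on the segment: first `F₂` differs from its value
at `(x, a)` by at most `A |b - a|`, then `F₁` minus its linear approximation has derivative of that
size. The sharp factor 1/2 is not needed. -/
theorem HasThreeFDerivOn.norm_first_taylor_le (hf : HasThreeFDerivOn f F₁ F₂ F₃ U)
    (hA₀ : 0 ≤ A) (hA : ∀ p ∈ U, ‖F₃ p‖ ≤ A) {x : E} {a b : ℝ}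
    (hseg : segment ℝ ((x, a) : E × ℝ) (x, b) ⊆ U) :
    ‖F₁ (x, b) - F₁ (x, a) - F₂ (x, a) (0, b - a)‖ ≤ A * |b - a| * |b - a| := by
  have hsub : ∀ p ∈ segment ℝ ((x, a) : E × ℝ) (x, b), ‖F₂ p - F₂ (x, a)‖ ≤ A * |b - a| := by
    intro p hp
    have hseg' : segment ℝ ((x, a) : E × ℝ) p ⊆ U :=
      ((convex_segment _ _).segment_subset (left_mem_segment ℝ _ _) hp).trans hseg
    have h1 := (convex_segment _ _).norm_image_sub_le_of_norm_hasFDerivWithin_le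
      (fun p hp => (hf.third p (hseg' hp)).hasFDerivWithinAt) (fun p hp => hA p (hseg' hp))
      (left_mem_segment ℝ _ _) (right_mem_segment ℝ _ _)
    refine h1.trans (mul_le_mul_of_nonneg_left ?_ hA₀)
    obtain ⟨t, ht, rfl⟩ := (segment_eq_image' ℝ ((x, a) : E × ℝ) (x, b)).subset hp
    rw [add_sub_cancel_left, norm_smul, norm_mk_sub_mk_left, Real.norm_eq_abs, abs_of_nonneg ht.1]
    exact mul_le_of_le_one_left (abs_nonneg _) ht.2
  have h := (convex_segment ((x, a) : E × ℝ) (x, b)).norm_image_sub_le_of_norm_hasFDerivWithin_le'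
    (fun p hp => (hf.second p (hseg hp)).hasFDerivWithinAt) hsub
    (left_mem_segment ℝ _ _) (right_mem_segment ℝ _ _)
  rw [norm_mk_sub_mk_left] at h
  simpa using h

/-- First order expansion of the derivative of a composition along a curve. -/
theorem HasThreeFDerivOn.abs_comp_graph_first_sub_le (hf : HasThreeFDerivOn f F₁ F₂ F₃ U)
    (hA₀ : 0 ≤ A) (hA₂ : ∀ p ∈ U, ‖F₂ p‖ ≤ A) (hA₃ : ∀ p ∈ U, ‖F₃ p‖ ≤ A) {x e : E} {a b C ρ : ℝ}
    (hseg : segment ℝ ((x, a) : E × ℝ) (x, b) ⊆ U) {l l' : E →L[ℝ] ℝ} (he : ‖e‖ ≤ 1)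
    (hl : ‖l‖ ≤ C) (hab : |b - a| ≤ ρ) (hll : ‖l' - l‖ ≤ ρ) :
    |(F₁ (x, b)).comp ((ContinuousLinearMap.id ℝ E).prod l') e -
      (F₁ (x, a)).comp ((ContinuousLinearMap.id ℝ E).prod l) e -
      (F₁ (x, a) (0, 1) * (l' e - l e) + F₂ (x, a) (0, 1) (e, l e) * (b - a))| ≤
      A * (2 + C) * ρ ^ 2 := by
  have hC : 0 ≤ C := (norm_nonneg _).trans hl
  have hρ : 0 ≤ ρ := (abs_nonneg _).trans hab
  have e1 : ((0 : E), b - a) = (b - a) • ((0 : E), (1 : ℝ)) := by simp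
  have e2 : ((0 : E), l' e - l e) = (l' e - l e) • ((0 : E), (1 : ℝ)) := by simp
  have e3 : ((e, l' e) : E × ℝ) = (e, l e) + (0, l' e - l e) := by simp
  -- Exact identity for the remainder: the Taylor remainder of `F₁` acting on the old tangent
  -- vector, plus the increment of `F₁` acting on the change of the tangent vector. Both are
  -- products of two small factors.
  have hid : (F₁ (x, b)).comp ((ContinuousLinearMap.id ℝ E).prod l') e -
      (F₁ (x, a)).comp ((ContinuousLinearMap.id ℝ E).prod l) e -
      (F₁ (x, a) (0, 1) * (l' e - l e) + F₂ (x, a) (0, 1) (e, l e) * (b - a)) =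
      (F₁ (x, b) - F₁ (x, a) - F₂ (x, a) (0, b - a)) (e, l e) +
      (F₁ (x, b) - F₁ (x, a)) (0, l' e - l e) := by
    change F₁ (x, b) (e, l' e) - F₁ (x, a) (e, l e) - _ = _
    rw [e3, e1]
    simp only [sub_apply, map_add, map_smul, smul_apply, smul_eq_mul]
    have e4 : F₁ (x, a) (0, l' e - l e) = (l' e - l e) * F₁ (x, a) (0, 1) := by
      rw [e2, map_smul, smul_eq_mul]
    rw [e4]
    ring
  rw [hid]
  have hle : |l e| ≤ C := by
    calc |l e| ≤ ‖l‖ * ‖e‖ := l.le_opNorm e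
      _ ≤ C * 1 := mul_le_mul hl he (norm_nonneg _) hC
      _ = C := mul_one C
  have hv : ‖((e, l e) : E × ℝ)‖ ≤ 1 + C := max_le (by linarith) (by
    rw [Real.norm_eq_abs]; linarith)
  have hw : ‖((0 : E), l' e - l e)‖ ≤ ρ := by
    rw [Prod.norm_def, norm_zero, max_eq_right (norm_nonneg _)]
    calc ‖l' e - l e‖ = ‖(l' - l) e‖ := by rw [sub_apply]
      _ ≤ ‖l' - l‖ * ‖e‖ := (l' - l).le_opNorm e
      _ ≤ ρ * 1 := mul_le_mul hll he (norm_nonneg _) hρ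
      _ = ρ := mul_one ρ
  have h1 : ‖F₁ (x, b) - F₁ (x, a) - F₂ (x, a) (0, b - a)‖ ≤ A * ρ * ρ :=
    (hf.norm_first_taylor_le hA₀ hA₃ hseg).trans (by gcongr)
  have h2 : ‖F₁ (x, b) - F₁ (x, a)‖ ≤ A * ρ :=
    (hf.norm_first_sub_le hA₂ hseg).trans (by gcongr)
  refine (abs_add_le _ _).trans ((add_le_add
    ((ContinuousLinearMap.le_opNorm _ _).trans (mul_le_mul h1 hv (norm_nonneg _) (by positivity)))
    ((ContinuousLinearMap.le_opNorm _ _).trans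
      (mul_le_mul h2 hw (norm_nonneg _) (by positivity)))).trans (le_of_eq ?_))
  ring

/-- Dependence of the second derivative of a composition on the curve. -/
theorem HasThreeFDerivOn.norm_comp_graph_second_sub_le (hf : HasThreeFDerivOn f F₁ F₂ F₃ U)
    (hA₀ : 0 ≤ A) (hA₁ : ∀ p ∈ U, ‖F₁ p‖ ≤ A) (hA₂ : ∀ p ∈ U, ‖F₂ p‖ ≤ A)
    (hA₃ : ∀ p ∈ U, ‖F₃ p‖ ≤ A) {x : E} {a b C ρ : ℝ}
    (hseg : segment ℝ ((x, a) : E × ℝ) (x, b) ⊆ U) {l l' : E →L[ℝ] ℝ} {m m' : E →L[ℝ] E →L[ℝ] ℝ}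
    (hl : ‖l‖ ≤ C) (hm : ‖m‖ ≤ C) (hab : |b - a| ≤ ρ) (hll : ‖l' - l‖ ≤ ρ) (hmm : ‖m' - m‖ ≤ ρ) :
    ‖secondFDerivComp (F₁ (x, b)) (F₂ (x, b)) ((ContinuousLinearMap.id ℝ E).prod l')
        ((inrComp E).comp m') -
      secondFDerivComp (F₁ (x, a)) (F₂ (x, a)) ((ContinuousLinearMap.id ℝ E).prod l)
        ((inrComp E).comp m)‖ ≤ A * (5 * (1 + C + ρ) ^ 2) * ρ := by
  have hC : 0 ≤ C := (norm_nonneg _).trans hl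
  have hρ : 0 ≤ ρ := (abs_nonneg _).trans hab
  have ha : (x, a) ∈ U := hseg (left_mem_segment ℝ _ _)
  have h1 : ‖F₁ (x, b) - F₁ (x, a)‖ ≤ A * ρ :=
    (hf.norm_first_sub_le hA₂ hseg).trans (by gcongr)
  have h2 : ‖F₂ (x, b) - F₂ (x, a)‖ ≤ A * ρ :=
    (hf.norm_second_sub_le hA₃ hseg).trans (by gcongr)
  have h3 : ‖l'‖ ≤ C + ρ := by
    have := norm_add_le l (l' - l)
    rw [add_sub_cancel] at this
    linarith
  have h4 : ‖m'‖ ≤ C + ρ := by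
    have := norm_add_le m (m' - m)
    rw [add_sub_cancel] at this
    linarith
  have h5 := (norm_prod_id_le l').trans (by linarith : 1 + ‖l'‖ ≤ 1 + C + ρ)
  have h6 := (norm_prod_id_le l).trans (by linarith : 1 + ‖l‖ ≤ 1 + C + ρ)
  have h7 := (norm_prod_id_sub_le l l').trans hll
  have h8 := (norm_inrComp_comp_le m').trans (by linarith : ‖m'‖ ≤ 1 + C + ρ)
  have h9 : ‖(inrComp E).comp m' - (inrComp E).comp m‖ ≤ ρ := by
    rw [← ContinuousLinearMap.comp_sub]
    exact (norm_inrComp_comp_le _).trans hmm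
  set s := 1 + C + ρ with hs
  have hs1 : 1 ≤ s := by linarith
  calc _ ≤ A * ρ * s + A * ρ + (A * ρ * s * s + A * ρ * s + A * s * ρ) := by
        refine (norm_secondFDerivComp_sub_le _ _ _ _ _ _ _ _).trans ?_
        gcongr
        · exact hA₁ _ ha
        · exact hA₂ _ ha
        · exact hA₂ _ ha
    _ = A * ρ * (s ^ 2 + 3 * s + 1) := by ring
    _ ≤ A * ρ * (5 * s ^ 2) := by
        refine mul_le_mul_of_nonneg_left ?_ (by positivity)
        nlinarith
    _ = _ := by ring

/-- Bound for the third derivative of a composition along a curve. -/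
theorem norm_comp_graph_third_le {A C : ℝ} {B₁ : E × ℝ →L[ℝ] ℝ} {B₂ : E × ℝ →L[ℝ] E × ℝ →L[ℝ] ℝ}
    {B₃ : E × ℝ →L[ℝ] E × ℝ →L[ℝ] E × ℝ →L[ℝ] ℝ} (h₁ : ‖B₁‖ ≤ A) (h₂ : ‖B₂‖ ≤ A) (h₃ : ‖B₃‖ ≤ A)
    {l : E →L[ℝ] ℝ} {m : E →L[ℝ] E →L[ℝ] ℝ} {k : E →L[ℝ] E →L[ℝ] E →L[ℝ] ℝ}
    (hl : ‖l‖ ≤ C) (hm : ‖m‖ ≤ C) (hk : ‖k‖ ≤ C) :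
    ‖B₃‖ * ‖(ContinuousLinearMap.id ℝ E).prod l‖ ^ 3 +
      3 * ‖B₂‖ * ‖(ContinuousLinearMap.id ℝ E).prod l‖ * ‖(inrComp E).comp m‖ +
      ‖B₁‖ * ‖(inrComp₂ E).comp k‖ ≤ A * (5 * (1 + C) ^ 3) := by
  have hC : 0 ≤ C := (norm_nonneg _).trans hl
  have hA : 0 ≤ A := (norm_nonneg _).trans h₁
  have h5 := (norm_prod_id_le l).trans (by linarith : 1 + ‖l‖ ≤ 1 + C)
  have h6 := (norm_inrComp_comp_le m).trans (by linarith : ‖m‖ ≤ 1 + C)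
  have h7 := (norm_inrComp₂_comp_le k).trans (by linarith : ‖k‖ ≤ 1 + C)
  set s := 1 + C with hs
  have hs1 : 1 ≤ s := by linarith
  calc _ ≤ A * s ^ 3 + 3 * A * s * s + A * s := by gcongr
    _ = A * (s ^ 3 + 3 * s ^ 2 + s) := by ring
    _ ≤ A * (5 * s ^ 3) := by
        refine mul_le_mul_of_nonneg_left ?_ hA
        nlinarith [pow_le_pow_right₀ hs1 (show 2 ≤ 3 by norm_num),
          le_self_pow₀ hs1 (show 3 ≠ 0 by norm_num)]

end GraphComposition

/-! ### Empirical processes over balls of `C¹[0,1]`. -/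

section EmpiricalProcess

variable {Ω 𝒳 : Type*} [MeasurableSpace Ω] [MeasurableSpace 𝒳]

/-- The second moment bound for centered i.i.d. sums, in `L¹` form. -/
theorem lintegral_enorm_sum_le_of_integral_eq_zero {μ : Measure Ω} [IsProbabilityMeasure μ]
    {P : Measure 𝒳} {X : ℕ → Ω → 𝒳} (hX : ∀ i, Measurable (X i)) (hind : iIndepFun X μ)
    (hlaw : ∀ i, μ.map (X i) = P) {m : 𝒳 → ℝ} (hm : Measurable m) (hm2 : MemLp m 2 P)
    (h0 : ∫ x, m x ∂P = 0) (n : ℕ) :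
    ∫⁻ ω, ‖∑ i ∈ Finset.range n, m (X i ω)‖ₑ ∂μ ≤
      ENNReal.ofReal (Real.sqrt (n * ∫ x, m x ^ 2 ∂P)) := by
  have hmp : ∀ i, MeasurePreserving (X i) μ P := fun i => ⟨hX i, hlaw i⟩
  have hL : ∀ i, MemLp (fun ω => m (X i ω)) 2 μ := fun i => hm2.comp_measurePreserving (hmp i)
  have hi0 : ∀ i, ∫ ω, m (X i ω) ∂μ = 0 := fun i => by
    rw [← h0, ← hlaw i, integral_map (hX i).aemeasurable]
    exact hm.aestronglyMeasurable
  have hi2 : ∀ i, ∫ ω, m (X i ω) ^ 2 ∂μ = ∫ x, m x ^ 2 ∂P := fun i => by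
    rw [← hlaw i, integral_map (hX i).aemeasurable]
    exact (hm.pow_const 2).aestronglyMeasurable
  set S : Ω → ℝ := ∑ i ∈ Finset.range n, fun ω => m (X i ω) with hS
  have hSL : MemLp S 2 μ := memLp_finsetSum' _ fun i _ => hL i
  have hSi : ∫ ω, S ω ∂μ = 0 := by
    simp only [hS, Finset.sum_apply]
    rw [integral_finsetSum _ fun i _ => (hL i).integrable (by norm_num)]
    exact Finset.sum_eq_zero fun i _ => hi0 i
  have hvar : Var[S; μ] = n * ∫ x, m x ^ 2 ∂P := by
    rw [hS, IndepFun.variance_sum (fun i _ => hL i)]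
    · have : ∀ i, Var[fun ω => m (X i ω); μ] = ∫ x, m x ^ 2 ∂P := fun i => by
        rw [variance_of_integral_eq_zero (hL i).aestronglyMeasurable.aemeasurable (hi0 i), hi2 i]
      simp [this]
    -- The variance of the sum only requires pairwise independence.
    · intro i _ j _ hij
      exact (hind.indepFun hij).comp hm hm
  have hS2 : ∫ ω, S ω ^ 2 ∂μ = n * ∫ x, m x ^ 2 ∂P := by
    rw [← hvar, variance_of_integral_eq_zero hSL.aestronglyMeasurable.aemeasurable hSi]
  have e1 : ∫⁻ ω, ‖∑ i ∈ Finset.range n, m (X i ω)‖ₑ ∂μ = eLpNorm S 1 μ := by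
    rw [eLpNorm_one_eq_lintegral_enorm]
    simp [hS, Finset.sum_apply]
  rw [e1]
  refine (eLpNorm_le_eLpNorm_of_exponent_le (by norm_num : (1 : ℝ≥0∞) ≤ 2)
    hSL.aestronglyMeasurable).trans (le_of_eq ?_)
  rw [hSL.eLpNorm_eq_integral_rpow_norm (by norm_num) (by norm_num), ← hS2, Real.sqrt_eq_rpow]
  norm_num

/-- A continuously differentiable function on `[0,1]` in terms of step functions. -/
theorem eq_add_integral_indicator_mul_derivWithin {f : ℝ → ℝ} (hf : ContDiffOn ℝ 1 f (Icc 0 1))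
    {z : ℝ} (hz : z ∈ Icc (0 : ℝ) 1) :
    f z = f 0 + ∫ u in Icc (0 : ℝ) 1, (if u ≤ z then 1 else 0) * derivWithin f (Icc 0 1) u := by
  have hc := ((contDiffOn_one_iff_derivWithin (uniqueDiffOn_Icc zero_lt_one)).1 hf)
  have h1 : ∫ u in (0 : ℝ)..z, derivWithin f (Icc 0 1) u = f z - f 0 := by
    refine intervalIntegral.integral_eq_sub_of_hasDerivAt_of_le hz.1
      (hf.continuousOn.mono (Icc_subset_Icc_right hz.2)) (fun x hx => ?_) ?_
    · have hx' : x ∈ Ioo (0 : ℝ) 1 := ⟨hx.1, hx.2.trans_le hz.2⟩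
      exact (hc.1 x (Ioo_subset_Icc_self hx')).hasDerivWithinAt.hasDerivAt
        (Icc_mem_nhds hx'.1 hx'.2)
    · refine (hc.2.mono ?_).intervalIntegrable
      rw [uIcc_of_le hz.1]
      exact Icc_subset_Icc_right hz.2
  have h2 : ∫ u in Icc (0 : ℝ) 1, (if u ≤ z then 1 else 0) * derivWithin f (Icc 0 1) u =
      ∫ u in Icc (0 : ℝ) z, derivWithin f (Icc 0 1) u := by
    have : (fun u => (if u ≤ z then (1 : ℝ) else 0) * derivWithin f (Icc 0 1) u) =
        (Iic z).indicator (derivWithin f (Icc 0 1)) := by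
      funext u
      by_cases hu : u ≤ z <;> simp [hu]
    rw [this, setIntegral_indicator measurableSet_Iic]
    congr 2
    ext u
    simp only [mem_inter_iff, mem_Icc, mem_Iic]
    exact ⟨fun h => ⟨h.1.1, h.2⟩, fun h => ⟨⟨h.1, h.2.trans hz.2⟩, h.2⟩⟩
  rw [h2, integral_Icc_eq_integral_Ioc, ← intervalIntegral.integral_of_le hz.1, h1]
  ring

/-- Uniform control of weighted sums over balls of `C¹[0,1]` by sums over step functions. -/
theorem enorm_sum_mul_le {n : ℕ} (a : ℕ → ℝ) (z : ℕ → ℝ) (hz : ∀ i, z i ∈ Icc (0 : ℝ) 1)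
    {f : ℝ → ℝ} {B : ℝ} (hf : ContDiffOn ℝ 1 f (Icc 0 1))
    (hB : ∀ u ∈ Icc (0 : ℝ) 1, |f u| ≤ B)
    (hB' : ∀ u ∈ Icc (0 : ℝ) 1, |derivWithin f (Icc 0 1) u| ≤ B) :
    ‖∑ i ∈ Finset.range n, a i * f (z i)‖ₑ ≤ ENNReal.ofReal B *
      (‖∑ i ∈ Finset.range n, a i‖ₑ + ∫⁻ u in Icc (0 : ℝ) 1,
        ‖∑ i ∈ Finset.range n, a i * (if u ≤ z i then 1 else 0)‖ₑ) := by
  have hc := ((contDiffOn_one_iff_derivWithin (uniqueDiffOn_Icc zero_lt_one)).1 hf)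
  have hint : ∀ i, IntegrableOn
      (fun u => (if u ≤ z i then 1 else 0) * derivWithin f (Icc 0 1) u) (Icc (0 : ℝ) 1) := by
    intro i
    have : (fun u => (if u ≤ z i then (1 : ℝ) else 0) * derivWithin f (Icc 0 1) u) =
        (Iic (z i)).indicator (derivWithin f (Icc 0 1)) := by
      funext u
      by_cases hu : u ≤ z i <;> simp [hu]
    rw [this]
    exact (hc.2.integrableOn_Icc).indicator measurableSet_Iic
  have e : ∑ i ∈ Finset.range n, a i * f (z i) = f 0 * ∑ i ∈ Finset.range n, a i +
      ∫ u in Icc (0 : ℝ) 1, derivWithin f (Icc 0 1) u *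
        ∑ i ∈ Finset.range n, a i * (if u ≤ z i then 1 else 0) := by
    have e1 : ∀ u, derivWithin f (Icc 0 1) u *
        ∑ i ∈ Finset.range n, a i * (if u ≤ z i then (1 : ℝ) else 0) =
        ∑ i ∈ Finset.range n, a i * ((if u ≤ z i then 1 else 0) * derivWithin f (Icc 0 1) u) := by
      intro u
      rw [Finset.mul_sum]
      exact Finset.sum_congr rfl fun i _ => by ring
    simp only [e1]
    rw [integral_finsetSum _ fun i _ => (hint i).const_mul (a i), Finset.mul_sum,
      ← Finset.sum_add_distrib]
    refine Finset.sum_congr rfl fun i _ => ?_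
    rw [integral_const_mul, eq_add_integral_indicator_mul_derivWithin hf (hz i)]
    ring
  rw [e, mul_add]
  refine (enorm_add_le _ _).trans (add_le_add ?_ ?_)
  · rw [enorm_mul]
    gcongr
    rw [Real.enorm_eq_ofReal_abs]
    exact ENNReal.ofReal_le_ofReal (hB 0 (by simp))
  · refine (enorm_integral_le_lintegral_enorm _).trans ?_
    rw [← lintegral_const_mul' _ _ ENNReal.ofReal_ne_top]
    refine setLIntegral_mono' measurableSet_Icc fun u hu => ?_
    rw [enorm_mul]
    gcongr
    rw [Real.enorm_eq_ofReal_abs]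
    exact ENNReal.ofReal_le_ofReal (hB' u hu)

/-- The centered empirical process `n⁻¹ ∑ m(Xᵢ) f(Zᵢ)` is of order `n^{-1/2}`, uniformly over `f`
in the unit ball of `C¹[0,1]`. -/
theorem exists_bigOP_forall_enorm_sum_mul_le {μ : Measure Ω} [IsProbabilityMeasure μ]
    {P : Measure 𝒳} {X : ℕ → Ω → 𝒳} (hX : ∀ i, Measurable (X i)) (hind : iIndepFun X μ)
    (hlaw : ∀ i, μ.map (X i) = P) {Z : 𝒳 → ℝ} (hZ : Measurable Z) (hZ01 : ∀ x, Z x ∈ Icc (0 : ℝ) 1)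
    {m : 𝒳 → ℝ} (hm2 : MemLp m 2 P)
    (h0 : ∀ u, ∫ x, m x * (if u ≤ Z x then 1 else 0) ∂P = 0) :
    ∃ W : ℕ → Ω → ℝ≥0∞, BigOP μ W (fun n => (n : ℝ) ^ (-(1 / 2) : ℝ)) ∧
      ∀ (n : ℕ) ω (f : ℝ → ℝ) (B : ℝ), ContDiffOn ℝ 1 f (Icc 0 1) →
        (∀ u ∈ Icc (0 : ℝ) 1, |f u| ≤ B) →
        (∀ u ∈ Icc (0 : ℝ) 1, |derivWithin f (Icc 0 1) u| ≤ B) →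
        ‖(1 / n : ℝ) * ∑ i ∈ Finset.range n, m (X i ω) * f (Z (X i ω))‖ₑ ≤
          ENNReal.ofReal B * W n ω := by
  -- The majorant does not involve `f`, so the bound also applies to functions chosen from the
  -- sample.
  set V : (𝒳 → ℝ) → ℕ → Ω → ℝ≥0∞ := fun m n ω => ‖(1 / n : ℝ)‖ₑ *
    (‖∑ i ∈ Finset.range n, m (X i ω)‖ₑ + ∫⁻ u in Icc (0 : ℝ) 1,
        ‖∑ i ∈ Finset.range n, m (X i ω) * (if u ≤ Z (X i ω) then 1 else 0)‖ₑ) with hV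
  refine ⟨V m, ?_, fun n ω f B hf hB hB' => ?_⟩
  swap
  · rw [enorm_mul, mul_left_comm]
    gcongr
    exact enorm_sum_mul_le (fun i => m (X i ω)) (fun i => Z (X i ω)) (fun i => hZ01 _) hf hB hB'
  -- Tonelli needs joint measurability in `(ω, u)`, so `m` is replaced by a measurable version;
  -- almost surely this changes no summand.
  obtain ⟨m', hm', hmm'⟩ : ∃ m', Measurable m' ∧ m =ᵐ[P] m' :=
    ⟨hm2.1.aemeasurable.mk m, hm2.1.aemeasurable.measurable_mk, hm2.1.aemeasurable.ae_eq_mk⟩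
  have hm2' : MemLp m' 2 P := hm2.ae_eq hmm'
  have hae : ∀ᵐ ω ∂μ, ∀ i, m (X i ω) = m' (X i ω) := by
    refine ae_all_iff.2 fun i => ?_
    have h : ∀ᵐ x ∂(μ.map (X i)), m x = m' x := by rw [hlaw i]; exact hmm'
    exact ae_of_ae_map (hX i).aemeasurable h
  have hVV : ∀ᵐ ω ∂μ, ∀ n, V m n ω = V m' n ω := by
    filter_upwards [hae] with ω hω n
    simp only [hV, hω]
  have hmeas2 : ∀ n, Measurable fun p : Ω × ℝ =>
      ‖∑ i ∈ Finset.range n, m' (X i p.1) * (if p.2 ≤ Z (X i p.1) then 1 else 0)‖ₑ := by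
    intro n
    refine Measurable.enorm (Finset.measurable_sum _ fun i _ => ?_)
    refine (hm'.comp ((hX i).comp measurable_fst)).mul (Measurable.ite ?_ measurable_const
      measurable_const)
    exact measurableSet_le measurable_snd (hZ.comp ((hX i).comp measurable_fst))
  have hmeas1 : ∀ n, Measurable fun ω => ‖∑ i ∈ Finset.range n, m' (X i ω)‖ₑ := fun n =>
    Measurable.enorm (Finset.measurable_sum _ fun i _ => hm'.comp (hX i))
  have hVmeas : ∀ n, Measurable (V m' n) := fun n =>
    ((hmeas1 n).add (hmeas2 n).lintegral_prod_right').const_mul _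
  set σ := ∫ x, m' x ^ 2 ∂P with hσ
  have hstep : ∀ u n, ∫⁻ ω, ‖∑ i ∈ Finset.range n, m' (X i ω) *
      (if u ≤ Z (X i ω) then 1 else 0)‖ₑ ∂μ ≤ ENNReal.ofReal (Real.sqrt (n * σ)) := by
    intro u n
    have hmu : Measurable fun x => m' x * (if u ≤ Z x then (1 : ℝ) else 0) :=
      hm'.mul (Measurable.ite (measurableSet_le measurable_const hZ) measurable_const
        measurable_const)
    have hle : ∀ x, ‖m' x * (if u ≤ Z x then (1 : ℝ) else 0)‖ ≤ ‖m' x‖ := fun x => by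
      split_ifs <;> simp
    have hmuL : MemLp (fun x => m' x * (if u ≤ Z x then (1 : ℝ) else 0)) 2 P :=
      hm2'.mono hmu.aestronglyMeasurable (Eventually.of_forall hle)
    have h0' : ∫ x, m' x * (if u ≤ Z x then (1 : ℝ) else 0) ∂P = 0 := by
      refine (integral_congr_ae ?_).trans (h0 u)
      filter_upwards [hmm'] with x hx
      rw [hx]
    refine (lintegral_enorm_sum_le_of_integral_eq_zero hX hind hlaw hmu hmuL h0' n).trans ?_
    refine ENNReal.ofReal_le_ofReal (Real.sqrt_le_sqrt ?_)
    refine mul_le_mul_of_nonneg_left ?_ (Nat.cast_nonneg n)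
    refine integral_mono hmuL.integrable_sq hm2'.integrable_sq fun x => ?_
    exact sq_le_sq.2 (hle x)
  have hbig : BigOP μ (V m') (fun n => (n : ℝ) ^ (-(1 / 2) : ℝ)) := by
    refine bigOP_of_lintegral_le (C := 2 * Real.sqrt σ) (fun n => (hVmeas n).aemeasurable) ?_ ?_
    · filter_upwards [eventually_gt_atTop 0] with n hn
      exact Real.rpow_pos_of_pos (by exact_mod_cast hn) _
    filter_upwards [eventually_gt_atTop 0] with n hn
    have hn' : (0 : ℝ) < n := by exact_mod_cast hn
    have hA : ∫⁻ ω, ‖∑ i ∈ Finset.range n, m' (X i ω)‖ₑ ∂μ ≤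
        ENNReal.ofReal (Real.sqrt (n * σ)) := by
      -- Since `Z ≥ 0`, the indicator at `u = 0` is identically one, and the plain sum is a special
      -- case of the step function sums.
      refine le_trans (le_of_eq ?_) (hstep 0 n)
      refine lintegral_congr fun ω => ?_
      congr 1
      refine Finset.sum_congr rfl fun i _ => ?_
      rw [if_pos (hZ01 _).1, mul_one]
    have hB : ∫⁻ ω, (∫⁻ u in Icc (0 : ℝ) 1, ‖∑ i ∈ Finset.range n, m' (X i ω) *
        (if u ≤ Z (X i ω) then 1 else 0)‖ₑ) ∂μ ≤ ENNReal.ofReal (Real.sqrt (n * σ)) := by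
      -- The bound is uniform in `u` and `[0,1]` has length one, so integrating over `u` costs
      -- nothing.
      rw [lintegral_lintegral_swap (hmeas2 n).aemeasurable]
      refine (lintegral_mono fun u => hstep u n).trans ?_
      simp
    rw [hV]
    dsimp only
    rw [lintegral_const_mul' _ _ enorm_ne_top, lintegral_add_left (hmeas1 n)]
    refine (mul_le_mul_right (add_le_add hA hB) _).trans (le_of_eq ?_)
    rw [Real.enorm_of_nonneg (by positivity), ← ENNReal.ofReal_add (by positivity) (by positivity),
      ← ENNReal.ofReal_mul (by positivity), Real.sqrt_mul hn'.le]
    congr 1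
    rw [Real.rpow_neg hn'.le, ← Real.sqrt_eq_rpow]
    have hs : Real.sqrt n * Real.sqrt n = n := Real.mul_self_sqrt hn'.le
    have hs0 : Real.sqrt n ≠ 0 := (Real.sqrt_pos.2 hn').ne'
    field_simp
    rw [sq, hs]
    ring
  intro ε hε
  obtain ⟨M, hM⟩ := hbig ε hε
  refine ⟨M, hM.mono fun n hn => le_trans (measure_mono_ae ?_) hn⟩
  filter_upwards [hVV] with ω hω h
  change _ < V m' n ω
  rw [← hω n]
  exact h

/-- Averages of an integrable function of identically distributed variables are bounded in
probability. -/
theorem bigOP_average {μ : Measure Ω} {P : Measure 𝒳} {X : ℕ → Ω → 𝒳} (hX : ∀ i, Measurable (X i))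
    (hlaw : ∀ i, μ.map (X i) = P) {A : 𝒳 → ℝ} (hA : Integrable A P) :
    BigOP μ (fun n ω => ENNReal.ofReal ((1 / n : ℝ) * ∑ i ∈ Finset.range n, |A (X i ω)|))
      (fun _ => 1) := by
  have hi : ∀ i, Integrable (fun ω => |A (X i ω)|) μ := fun i => by
    have : Integrable A (μ.map (X i)) := by rw [hlaw i]; exact hA
    exact (this.comp_measurable (hX i)).abs
  have he : ∀ i, ∫ ω, |A (X i ω)| ∂μ = ∫ x, |A x| ∂P := fun i => by
    rw [← hlaw i, integral_map (hX i).aemeasurable]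
    rw [hlaw i]
    exact hA.abs.aestronglyMeasurable
  refine bigOP_of_lintegral_le (C := ∫ x, |A x| ∂P) (fun n => ?_)
    (Eventually.of_forall fun _ => one_pos) ?_
  · refine AEMeasurable.ennreal_ofReal ?_
    exact ((integrable_finsetSum _ fun i _ => hi i).const_mul _).aestronglyMeasurable.aemeasurable
  · filter_upwards [eventually_gt_atTop 0] with n hn
    have hn' : (0 : ℝ) < n := by exact_mod_cast hn
    rw [← ofReal_integral_eq_lintegral_ofReal
      ((integrable_finsetSum _ fun i _ => hi i).const_mul _)
      (Eventually.of_forall fun ω => mul_nonneg (by positivity)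
        (Finset.sum_nonneg fun _ _ => abs_nonneg _)),
      integral_const_mul, integral_finsetSum _ fun i _ => hi i]
    simp only [he, Finset.sum_const, Finset.card_range, nsmul_eq_mul]
    refine ENNReal.ofReal_le_ofReal (le_of_eq ?_)
    field_simp

end EmpiricalProcess

/-! ### Differentiation under the integral, and passage from smooth functions to indicators. -/

section DifferentiationUnderIntegral

variable {𝒳 : Type*} [MeasurableSpace 𝒳] {P : Measure 𝒳}

/-- The derivative is an almost everywhere limit of difference quotients. Quotients at points `t`
where `F t` is not known to be measurable are replaced by zero, which does not affect the limit. -/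
theorem aestronglyMeasurable_of_hasDerivAt {F : ℝ → 𝒳 → ℝ} {F' : 𝒳 → ℝ} {t₀ : ℝ}
    (hF : ∀ᶠ t in 𝓝 t₀, AEStronglyMeasurable (F t) P)
    (hd : ∀ᵐ x ∂P, HasDerivAt (fun t => F t x) (F' x) t₀) : AEStronglyMeasurable F' P := by
  classical
  refine aestronglyMeasurable_of_tendsto_ae (𝓝[≠] t₀)
    (f := fun t x => if AEStronglyMeasurable (F t) P then slope (fun s => F s x) t₀ t else 0)
    (fun t => ?_) ?_
  · by_cases h : AEStronglyMeasurable (F t) P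
    · simp only [h, if_true, slope_def_module]
      exact (h.sub hF.self_of_nhds).const_smul ((t - t₀)⁻¹)
    · simp only [h, if_false]
      exact aestronglyMeasurable_const
  · filter_upwards [hd] with x hx
    refine (hasDerivAt_iff_tendsto_slope.1 hx).congr' ?_
    filter_upwards [nhdsWithin_le_nhds hF] with t ht
    rw [if_pos ht]

/-- Measurability of the derivative need not be assumed. This matters because the model only
provides measurability of the likelihood itself, not of its derivatives. -/
theorem hasDerivAt_integral_of_dominated {F F' : ℝ → 𝒳 → ℝ} {bound : 𝒳 → ℝ} {t₀ ε : ℝ}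
    (hε : 0 < ε) (hF : ∀ t ∈ Metric.ball t₀ ε, AEStronglyMeasurable (F t) P)
    (hF₀ : Integrable (F t₀) P) (hbound : Integrable bound P)
    (hd : ∀ᵐ x ∂P, ∀ t ∈ Metric.ball t₀ ε,
      HasDerivAt (fun t => F t x) (F' t x) t ∧ ‖F' t x‖ ≤ bound x) :
    Integrable (F' t₀) P ∧ HasDerivAt (fun t => ∫ x, F t x ∂P) (∫ x, F' t₀ x ∂P) t₀ := by
  have hF' : ∀ᶠ t in 𝓝 t₀, AEStronglyMeasurable (F t) P := by
    filter_upwards [Metric.ball_mem_nhds t₀ hε] with t ht using hF t ht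
  refine hasDerivAt_integral_of_dominated_loc_of_deriv_le (Metric.ball_mem_nhds t₀ hε) hF' hF₀
    (aestronglyMeasurable_of_hasDerivAt hF'
      (hd.mono fun x hx => (hx t₀ (Metric.mem_ball_self hε)).1))
    (hd.mono fun x hx t ht => (hx t ht).2) hbound (hd.mono fun x hx t ht => (hx t ht).1)

/-- A function that is orthogonal to all smooth functions of `Z` is orthogonal to the indicators
of half-lines. -/
theorem integral_mul_indicator_eq_zero {m : 𝒳 → ℝ} {Z : 𝒳 → ℝ} (hm : Integrable m P)
    (hZ : Measurable Z) (h : ∀ φ : ℝ → ℝ, ContDiff ℝ 2 φ → ∫ x, m x * φ (Z x) ∂P = 0) (u : ℝ) :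
    ∫ x, m x * (if u ≤ Z x then 1 else 0) ∂P = 0 := by
  -- Smooth ramps that vanish for `z ≤ u - 1/k` and equal one for `z ≥ u`. The shift by one makes
  -- the limit equal to one at `z = u` as well.
  set φ : ℕ → ℝ → ℝ := fun k z => Real.smoothTransition (k * (z - u) + 1) with hφ
  have hφs : ∀ k, ContDiff ℝ 2 (φ k) := fun k =>
    (Real.smoothTransition.contDiff (n := 2)).comp (by fun_prop)
  have hlim : Tendsto (fun k => ∫ x, m x * φ k (Z x) ∂P) atTop
      (𝓝 (∫ x, m x * (if u ≤ Z x then 1 else 0) ∂P)) := by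
    refine tendsto_integral_of_dominated_convergence (fun x => ‖m x‖) (fun k => ?_) hm.norm
      (fun k => Eventually.of_forall fun x => ?_) (Eventually.of_forall fun x => ?_)
    · exact hm.aestronglyMeasurable.mul
        ((hφs k).continuous.measurable.comp hZ).aestronglyMeasurable
    · rw [norm_mul]
      refine mul_le_of_le_one_right (norm_nonneg _) ?_
      rw [Real.norm_eq_abs, abs_of_nonneg (Real.smoothTransition.nonneg _)]
      exact Real.smoothTransition.le_one _
    · refine Tendsto.const_mul _ ?_
      split_ifs with hu
      · refine tendsto_const_nhds.congr fun k => ?_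
        refine (Real.smoothTransition.one_of_one_le ?_).symm
        have : (0 : ℝ) ≤ k * (Z x - u) := mul_nonneg (Nat.cast_nonneg k) (by linarith)
        linarith
      · push Not at hu
        obtain ⟨k₀, hk₀⟩ := exists_nat_ge (1 / (u - Z x))
        refine tendsto_const_nhds.congr' ?_
        filter_upwards [eventually_ge_atTop k₀] with k hk
        refine (Real.smoothTransition.zero_of_nonpos ?_).symm
        have h1 : 1 / (u - Z x) ≤ (k : ℝ) := hk₀.trans (by exact_mod_cast hk)
        rw [div_le_iff₀ (by linarith)] at h1
        linarith
  refine tendsto_nhds_unique hlim ?_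
  simp only [h _ (hφs _)]
  exact tendsto_const_nhds

end DifferentiationUnderIntegral

/-! ### Orthogonality of the scores to functions of `Z`. -/

namespace CondParamModel

section Scores

set_option maxSynthPendingDepth 3

variable {d : ℕ} {𝒴 𝒲 : Type*} [MeasurableSpace 𝒴] [MeasurableSpace 𝒲]

/-- The log-likelihood of one observation as a function of the pair `(θ, λ)`. -/
abbrev logDensity (M : CondParamModel d 𝒴 𝒲) (x : 𝒴 × (𝒲 × unitInterval)) :
    EuclideanSpace ℝ (Fin d) × ℝ → ℝ :=
  fun p => M.loglik x p.1 p.2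

/-- The log-likelihood at `x` is of class `C⁴` with derivatives bounded by `A x`. -/
structure IsRegularAt (M : CondParamModel d 𝒴 𝒲) (A : 𝒴 × (𝒲 × unitInterval) → ℝ)
    (x : 𝒴 × (𝒲 × unitInterval)) : Prop where
  contDiffOn : ContDiffOn ℝ 4 (M.logDensity x) (interior M.Θ ×ˢ interior M.H)
  norm_le : ∀ k ≤ 4, ∀ p ∈ interior M.Θ ×ˢ interior M.H,
    ‖iteratedFDeriv ℝ k (M.logDensity x) p‖ ≤ A x

theorem isOpen_interior_prod (M : CondParamModel d 𝒴 𝒲) :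
    IsOpen (interior M.Θ ×ˢ interior M.H) :=
  isOpen_interior.prod isOpen_interior

namespace IsRegularAt

variable {M : CondParamModel d 𝒴 𝒲} {A : 𝒴 × (𝒲 × unitInterval) → ℝ}
  {x : 𝒴 × (𝒲 × unitInterval)}

theorem hasThreeFDerivOn (h : M.IsRegularAt A x) :
    HasThreeFDerivOn (M.logDensity x) (fderiv ℝ (M.logDensity x))
      (fderiv ℝ (fderiv ℝ (M.logDensity x))) (fderiv ℝ (fderiv ℝ (fderiv ℝ (M.logDensity x))))
      (interior M.Θ ×ˢ interior M.H) :=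
  (h.contDiffOn.of_le (by norm_num)).hasThreeFDerivOn M.isOpen_interior_prod

theorem abs_le (h : M.IsRegularAt A x) {p : EuclideanSpace ℝ (Fin d) × ℝ}
    (hp : p ∈ interior M.Θ ×ˢ interior M.H) : |M.logDensity x p| ≤ A x := by
  simpa using h.norm_le 0 (by norm_num) p hp

theorem norm_first_le (h : M.IsRegularAt A x) {p : EuclideanSpace ℝ (Fin d) × ℝ}
    (hp : p ∈ interior M.Θ ×ˢ interior M.H) : ‖fderiv ℝ (M.logDensity x) p‖ ≤ A x := by
  rw [← h.hasThreeFDerivOn.norm_iteratedFDeriv_one hp]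
  exact h.norm_le 1 (by norm_num) p hp

theorem norm_second_le (h : M.IsRegularAt A x) {p : EuclideanSpace ℝ (Fin d) × ℝ}
    (hp : p ∈ interior M.Θ ×ˢ interior M.H) :
    ‖fderiv ℝ (fderiv ℝ (M.logDensity x)) p‖ ≤ A x := by
  rw [← h.hasThreeFDerivOn.norm_iteratedFDeriv_two M.isOpen_interior_prod hp]
  exact h.norm_le 2 (by norm_num) p hp

theorem norm_third_le (h : M.IsRegularAt A x) {p : EuclideanSpace ℝ (Fin d) × ℝ}
    (hp : p ∈ interior M.Θ ×ˢ interior M.H) :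
    ‖fderiv ℝ (fderiv ℝ (fderiv ℝ (M.logDensity x))) p‖ ≤ A x := by
  rw [← h.hasThreeFDerivOn.norm_iteratedFDeriv_three M.isOpen_interior_prod hp]
  exact h.norm_le 3 (by norm_num) p hp

/-- Differentiating the score in `λ` along a curve puts the tangent vector in the first slot,
whereas the expansion of the profile derivative has it in the second. -/
theorem second_symm (h : M.IsRegularAt A x) {p : EuclideanSpace ℝ (Fin d) × ℝ}
    (hp : p ∈ interior M.Θ ×ˢ interior M.H) (u v : EuclideanSpace ℝ (Fin d) × ℝ) :
    fderiv ℝ (fderiv ℝ (M.logDensity x)) p u v = fderiv ℝ (fderiv ℝ (M.logDensity x)) p v u :=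
  (h.contDiffOn.contDiffAt (M.isOpen_interior_prod.mem_nhds hp)).isSymmSndFDerivAt
    (by simp only [minSmoothness_of_isRCLikeNormedField]; norm_num) u v

end IsRegularAt

variable (M : CondParamModel d 𝒴 𝒲) {θ₀ : EuclideanSpace ℝ (Fin d)} {η₀ : ℝ → ℝ}

/-- The envelopes of the five orders are merged into one by summing their absolute values. -/
theorem ConditionK2.exists_isRegularAt {M : CondParamModel d 𝒴 𝒲} (h : M.ConditionK2 θ₀ η₀) :
    ∃ A, MemLp A 2 (M.law θ₀ η₀) ∧ ∀ᵐ x ∂(M.law θ₀ η₀), M.IsRegularAt A x := by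
  obtain ⟨-, h1, h2⟩ := h
  have h2' : ∀ k : Fin 5, ∃ A : 𝒴 × (𝒲 × unitInterval) → ℝ, MemLp A 2 (M.law θ₀ η₀) ∧
      ∀ᵐ x ∂(M.law θ₀ η₀), ∀ θ ∈ interior M.Θ, ∀ l ∈ interior M.H,
        ‖iteratedFDeriv ℝ (k : ℕ) (M.logDensity x) (θ, l)‖ ≤ A x := fun k => h2 k (by omega)
  choose A hA hAx using h2'
  refine ⟨fun x => ∑ k, |A k x|, memLp_finsetSum _ fun k _ => (hA k).abs, ?_⟩
  filter_upwards [h1, ae_all_iff.2 hAx] with x hx1 hx2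
  refine ⟨hx1, fun k hk p hp => (hx2 ⟨k, by omega⟩ p.1 hp.1 p.2 hp.2).trans ?_⟩
  exact (le_abs_self _).trans (Finset.single_le_sum (f := fun k => |A k x|)
    (fun _ _ => abs_nonneg _) (Finset.mem_univ _))

/-- The likelihood is jointly measurable only on the subtype `H`, so the curve is first lifted to a
continuous map from `[0,1]` into that subtype. -/
theorem measurable_loglik_comp {θ : EuclideanSpace ℝ (Fin d)} (hθ : θ ∈ M.Θ) {h : ℝ → ℝ}
    (hc : ContinuousOn h (Icc 0 1)) (hH : ∀ z ∈ Icc (0 : ℝ) 1, h z ∈ M.H) :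
    Measurable fun x : 𝒴 × (𝒲 × unitInterval) => M.loglik x θ (h x.2.2) := by
  have h1 : Continuous fun z : unitInterval => (⟨h z, hH z z.2⟩ : M.H) :=
    Continuous.subtype_mk (continuousOn_iff_continuous_domRestrict.1 hc) _
  have h2 : Measurable fun x : 𝒴 × (𝒲 × unitInterval) =>
      (x, (⟨h x.2.2, hH x.2.2 x.2.2.2⟩ : M.H)) :=
    measurable_id.prodMk (h1.measurable.comp (measurable_snd.comp measurable_snd))
  exact Real.measurable_log.comp ((M.measurable_lik θ hθ).comp h2).coe_nnreal_real

/-- The values of a curve in the nuisance space keep a positive distance from the complement of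
the interior of `H`. -/
theorem exists_forall_abs_sub_lt_mem_interior {h : ℝ → ℝ} (hh : h ∈ M.nuisanceSpace) :
    ∃ ρ > 0, ∀ z ∈ Icc (0 : ℝ) 1, ∀ l, |l - h z| < ρ → l ∈ interior M.H := by
  obtain ⟨ρ, hρ, hsub⟩ := (isCompact_Icc.image_of_continuousOn
    hh.1.continuousOn).exists_thickening_subset_open isOpen_interior
      (image_subset_iff.2 hh.2 : h '' Icc 0 1 ⊆ interior M.H)
  exact ⟨ρ, hρ, fun z hz l hl => hsub (Metric.mem_thickening_iff.2
    ⟨h z, mem_image_of_mem h hz, by rwa [Real.dist_eq]⟩)⟩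

theorem exists_forall_abs_le_of_contDiff {φ : ℝ → ℝ} (hφ : ContDiff ℝ 2 φ) :
    ∃ C, 0 ≤ C ∧ ∀ z ∈ Icc (0 : ℝ) 1, |φ z| ≤ C := by
  obtain ⟨C, hC⟩ := isCompact_Icc.exists_bound_of_continuousOn
    (hφ.continuous.continuousOn (s := Icc (0 : ℝ) 1))
  exact ⟨C, (norm_nonneg _).trans (hC 0 (by simp)), hC⟩

variable {M} {A : 𝒴 × (𝒲 × unitInterval) → ℝ} [IsProbabilityMeasure (M.law θ₀ η₀)]

/-- The first order condition for the least favorable curve. -/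
theorem IsLeastFavorableAt.integral_score_mul_eq_zero {θ : EuclideanSpace ℝ (Fin d)} {h : ℝ → ℝ}
    (hh : M.IsLeastFavorableAt θ₀ η₀ θ h) (hθ : θ ∈ interior M.Θ) (hA : MemLp A 2 (M.law θ₀ η₀))
    (hreg : ∀ᵐ x ∂(M.law θ₀ η₀), M.IsRegularAt A x) {φ : ℝ → ℝ} (hφ : ContDiff ℝ 2 φ) :
    Integrable (fun x => fderiv ℝ (M.logDensity x) (θ, h x.2.2) (0, 1) * φ x.2.2) (M.law θ₀ η₀) ∧
    ∫ x, fderiv ℝ (M.logDensity x) (θ, h x.2.2) (0, 1) * φ x.2.2 ∂(M.law θ₀ η₀) = 0 := by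
  obtain ⟨C, hC0, hC⟩ := exists_forall_abs_le_of_contDiff hφ
  obtain ⟨ρ, hρ, hρH⟩ := M.exists_forall_abs_sub_lt_mem_interior hh.1
  -- For `|t| < ε` the perturbed curve `h + t φ` moves by less than `ρ` and stays in the nuisance
  -- space; the added one covers `C = 0`.
  set ε := ρ / (C + 1) with hε
  have hεpos : 0 < ε := by positivity
  have hin : ∀ t ∈ Metric.ball (0 : ℝ) ε, ∀ z ∈ Icc (0 : ℝ) 1, h z + t * φ z ∈ interior M.H := by
    intro t ht z hz
    refine hρH z hz _ ?_
    rw [add_sub_cancel_left, abs_mul]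
    rw [mem_ball_zero_iff, Real.norm_eq_abs, hε, lt_div_iff₀ (by positivity)] at ht
    calc |t| * |φ z| ≤ |t| * (C + 1) :=
          mul_le_mul_of_nonneg_left ((hC z hz).trans (by linarith)) (abs_nonneg _)
      _ < ρ := ht
  have hnuis : ∀ t ∈ Metric.ball (0 : ℝ) ε, (fun z => h z + t * φ z) ∈ M.nuisanceSpace :=
    fun t ht => ⟨hh.1.1.add (contDiffOn_const.mul hφ.contDiffOn), hin t ht⟩
  have hAi : Integrable A (M.law θ₀ η₀) := hA.integrable (by norm_num)
  have hmeas : ∀ t ∈ Metric.ball (0 : ℝ) ε,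
      AEStronglyMeasurable (fun x => M.loglik x θ (h x.2.2 + t * φ x.2.2)) (M.law θ₀ η₀) :=
    fun t ht => (M.measurable_loglik_comp (interior_subset hθ) (hnuis t ht).1.continuousOn
      fun z hz => interior_subset (hin t ht z hz)).aestronglyMeasurable
  have hint : ∀ t ∈ Metric.ball (0 : ℝ) ε,
      Integrable (fun x => M.loglik x θ (h x.2.2 + t * φ x.2.2)) (M.law θ₀ η₀) := by
    intro t ht
    refine hAi.mono' (hmeas t ht) ?_
    filter_upwards [hreg] with x hx
    exact hx.abs_le (p := (θ, _)) ⟨hθ, hin t ht _ x.2.2.2⟩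
  have h0 : (0 : ℝ) ∈ Metric.ball (0 : ℝ) ε := Metric.mem_ball_self hεpos
  have hder := hasDerivAt_integral_of_dominated (P := M.law θ₀ η₀)
    (F := fun t x => M.loglik x θ (h x.2.2 + t * φ x.2.2))
    (F' := fun t x => fderiv ℝ (M.logDensity x) (θ, h x.2.2 + t * φ x.2.2) (0, φ x.2.2))
    (bound := fun x => A x * C) hεpos hmeas (hint 0 h0) (hAi.mul_const C) (by
      filter_upwards [hreg] with x hx t ht
      have hp : (θ, h x.2.2 + t * φ x.2.2) ∈ interior M.Θ ×ˢ interior M.H :=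
        ⟨hθ, hin t ht _ x.2.2.2⟩
      refine ⟨?_, ?_⟩
      · have hline : HasDerivAt (fun t => ((θ, h x.2.2 + t * φ x.2.2) :
            EuclideanSpace ℝ (Fin d) × ℝ)) (0, φ x.2.2) t := by
          refine (hasDerivAt_const t θ).prodMk ?_
          simpa using ((hasDerivAt_id t).mul_const (φ x.2.2)).const_add (h x.2.2)
        exact (hx.hasThreeFDerivOn.first _ hp).comp_hasDerivAt t hline
      · refine (ContinuousLinearMap.le_opNorm _ _).trans
          (mul_le_mul (hx.norm_first_le hp) ?_ (norm_nonneg _)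
            ((norm_nonneg _).trans (hx.norm_first_le hp)))
        rw [Prod.norm_def, norm_zero, max_eq_right (norm_nonneg _)]
        exact hC _ x.2.2.2)
  -- Integrating the conditional inequality removes the conditioning by the tower property, so `t =
  -- 0` maximizes an ordinary function of one real variable.
  have hmax : IsLocalMax (fun t => ∫ x, M.loglik x θ (h x.2.2 + t * φ x.2.2) ∂(M.law θ₀ η₀)) 0 := by
    filter_upwards [Metric.ball_mem_nhds 0 hεpos] with t ht
    have hm : MeasurableSpace.comap (fun x : 𝒴 × (𝒲 × unitInterval) => x.2.2) inferInstance ≤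
        (inferInstance : MeasurableSpace (𝒴 × (𝒲 × unitInterval))) :=
      (measurable_snd.comp measurable_snd).comap_le
    have h1 := integral_mono_ae integrable_condExp integrable_condExp (hh.2 _ (hnuis t ht))
    rw [integral_condExp hm, integral_condExp hm] at h1
    simpa using h1
  have hz := hmax.hasDerivAt_eq_zero hder.2
  have heq : ∀ x : 𝒴 × (𝒲 × unitInterval),
      fderiv ℝ (M.logDensity x) (θ, h x.2.2 + 0 * φ x.2.2) (0, φ x.2.2) =
        fderiv ℝ (M.logDensity x) (θ, h x.2.2) (0, 1) * φ x.2.2 := by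
    intro x
    have : ((0, φ x.2.2) : EuclideanSpace ℝ (Fin d) × ℝ) = φ x.2.2 • (0, 1) := by simp
    rw [this, map_smul, smul_eq_mul, zero_mul, add_zero, mul_comm]
  simp only [heq] at hz hder
  exact ⟨hder.1, hz⟩

/-- The derivative in `θ` of the first order condition for the least favorable curve. -/
theorem integral_score_deriv_mul_eq_zero {N : Set (EuclideanSpace ℝ (Fin d))} (hN : IsOpen N)
    (hθ₀ : θ₀ ∈ N) (hNΘ : N ⊆ interior M.Θ) {ηs : EuclideanSpace ℝ (Fin d) → ℝ → ℝ}
    (hηs : ∀ θ ∈ N, M.IsLeastFavorableAt θ₀ η₀ θ (ηs θ))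
    (hdiff : ∀ z ∈ Icc (0 : ℝ) 1, ∀ θ ∈ N, DifferentiableAt ℝ (fun t => ηs t z) θ) {C : ℝ}
    (hC : ∀ θ ∈ N, ∀ z ∈ Icc (0 : ℝ) 1, ‖fderiv ℝ (fun t => ηs t z) θ‖ ≤ C)
    (hA : MemLp A 2 (M.law θ₀ η₀)) (hreg : ∀ᵐ x ∂(M.law θ₀ η₀), M.IsRegularAt A x)
    (e : EuclideanSpace ℝ (Fin d)) {φ : ℝ → ℝ} (hφ : ContDiff ℝ 2 φ) :
    Integrable (fun x => fderiv ℝ (fderiv ℝ (M.logDensity x)) (θ₀, ηs θ₀ x.2.2) (0, 1)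
      (e, fderiv ℝ (fun t => ηs t x.2.2) θ₀ e) * φ x.2.2) (M.law θ₀ η₀) ∧
    ∫ x, fderiv ℝ (fderiv ℝ (M.logDensity x)) (θ₀, ηs θ₀ x.2.2) (0, 1)
      (e, fderiv ℝ (fun t => ηs t x.2.2) θ₀ e) * φ x.2.2 ∂(M.law θ₀ η₀) = 0 := by
  obtain ⟨D, hD0, hD⟩ := exists_forall_abs_le_of_contDiff hφ
  have hAi : Integrable A (M.law θ₀ η₀) := hA.integrable (by norm_num)
  obtain ⟨ε, hε, hεN⟩ : ∃ ε > 0, ∀ t ∈ Metric.ball (0 : ℝ) ε, θ₀ + t • e ∈ N := by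
    have hc : ContinuousAt (fun t : ℝ => θ₀ + t • e) 0 := by fun_prop
    exact Metric.mem_nhds_iff.1 (hc.preimage_mem_nhds (hN.mem_nhds (by simpa using hθ₀)))
  have hp : ∀ t ∈ Metric.ball (0 : ℝ) ε, ∀ z ∈ Icc (0 : ℝ) 1,
      (θ₀ + t • e, ηs (θ₀ + t • e) z) ∈ interior M.Θ ×ˢ interior M.H :=
    fun t ht z hz => ⟨hNΘ (hεN t ht), (hηs _ (hεN t ht)).1.2 z hz⟩
  have hscore := fun t (ht : t ∈ Metric.ball (0 : ℝ) ε) =>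
    (hηs _ (hεN t ht)).integral_score_mul_eq_zero (hNΘ (hεN t ht)) hA hreg hφ
  have h0 : (0 : ℝ) ∈ Metric.ball (0 : ℝ) ε := Metric.mem_ball_self hε
  -- The first order condition holds at every `θ` near `θ₀`, each time with the curve belonging to
  -- that `θ`. It is differentiated along the line `θ₀ + t e`, with the curve moving along.
  have hder := hasDerivAt_integral_of_dominated (P := M.law θ₀ η₀)
    (F := fun t x => fderiv ℝ (M.logDensity x) (θ₀ + t • e, ηs (θ₀ + t • e) x.2.2) (0, 1) * φ x.2.2)
    (F' := fun t x => fderiv ℝ (fderiv ℝ (M.logDensity x)) (θ₀ + t • e, ηs (θ₀ + t • e) x.2.2)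
      (e, fderiv ℝ (fun t => ηs t x.2.2) (θ₀ + t • e) e) (0, 1) * φ x.2.2)
    (bound := fun x => A x * (‖e‖ + C * ‖e‖) * D) hε (fun t ht => (hscore t ht).1.1) (hscore 0 h0).1
    ((hAi.mul_const _).mul_const D) (by
      filter_upwards [hreg] with x hx t ht
      have hpx := hp t ht _ x.2.2.2
      have hA0 : 0 ≤ A x := (norm_nonneg _).trans (hx.norm_first_le hpx)
      refine ⟨?_, ?_⟩
      · have hl : HasDerivAt (fun t : ℝ => θ₀ + t • e) e t := by
          simpa using ((hasDerivAt_id t).smul_const e).const_add θ₀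
        have hq : HasDerivAt (fun t : ℝ => ηs (θ₀ + t • e) x.2.2)
            (fderiv ℝ (fun t => ηs t x.2.2) (θ₀ + t • e) e) t := by
          have hf := (hdiff _ x.2.2.2 _ (hεN t ht)).hasFDerivAt
          exact hf.comp_hasDerivAt t hl
        have h1 := (hx.hasThreeFDerivOn.second _ hpx).comp_hasDerivAt t (hl.prodMk hq)
        have h2 := h1.clm_apply (hasDerivAt_const t ((0, 1) : EuclideanSpace ℝ (Fin d) × ℝ))
        simpa using h2.mul_const (φ x.2.2)
      · rw [norm_mul]
        refine mul_le_mul ?_ (hD _ x.2.2.2) (norm_nonneg _) ?_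
        · refine (ContinuousLinearMap.le_opNorm₂ _ _ _).trans ?_
          have n1 : ‖((0, 1) : EuclideanSpace ℝ (Fin d) × ℝ)‖ = 1 := by
            simp [Prod.norm_def]
          rw [n1, mul_one]
          refine mul_le_mul (hx.norm_second_le hpx) ?_ (norm_nonneg _) hA0
          have n2 : ‖fderiv ℝ (fun t => ηs t x.2.2) (θ₀ + t • e) e‖ ≤ C * ‖e‖ :=
            (ContinuousLinearMap.le_opNorm _ _).trans
              (mul_le_mul_of_nonneg_right (hC _ (hεN t ht) _ x.2.2.2) (norm_nonneg _))
          exact max_le (le_add_of_nonneg_right ((norm_nonneg _).trans n2))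
            (n2.trans (le_add_of_nonneg_left (norm_nonneg _)))
        · refine mul_nonneg hA0 (add_nonneg (norm_nonneg _) (mul_nonneg ?_ (norm_nonneg _)))
          exact (norm_nonneg _).trans (hC _ hθ₀ _ x.2.2.2))
  -- The integral vanishes for all small `t`, hence so does its derivative.
  have hz : ∫ x, fderiv ℝ (fderiv ℝ (M.logDensity x)) (θ₀ + (0 : ℝ) • e,
      ηs (θ₀ + (0 : ℝ) • e) x.2.2) (e, fderiv ℝ (fun t => ηs t x.2.2) (θ₀ + (0 : ℝ) • e) e) (0, 1) *
        φ x.2.2 ∂(M.law θ₀ η₀) = 0 := by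
    refine hder.2.unique ((hasDerivAt_const (0 : ℝ) (0 : ℝ)).congr_of_eventuallyEq ?_)
    filter_upwards [Metric.ball_mem_nhds 0 hε] with t ht using (hscore t ht).2
  have heq : (fun x => fderiv ℝ (fderiv ℝ (M.logDensity x)) (θ₀ + (0 : ℝ) • e,
      ηs (θ₀ + (0 : ℝ) • e) x.2.2) (e, fderiv ℝ (fun t => ηs t x.2.2) (θ₀ + (0 : ℝ) • e) e) (0, 1) *
        φ x.2.2) =ᵐ[M.law θ₀ η₀]
      fun x => fderiv ℝ (fderiv ℝ (M.logDensity x)) (θ₀, ηs θ₀ x.2.2) (0, 1)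
        (e, fderiv ℝ (fun t => ηs t x.2.2) θ₀ e) * φ x.2.2 := by
    filter_upwards [hreg] with x hx
    rw [zero_smul, add_zero, hx.second_symm]
    exact ⟨hNΘ hθ₀, (hηs _ hθ₀).1.2 _ x.2.2.2⟩
  exact ⟨hder.1.congr heq, (integral_congr_ae heq).symm.trans hz⟩

end Scores

end CondParamModel

/-! ### From stochastic orders and suprema to pointwise bounds. -/

theorem BigOP.withProbTendingToOne_le {Ω : Type*} [MeasurableSpace Ω] {μ : Measure Ω}
    {R : ℕ → Ω → ℝ≥0∞} {r : ℕ → ℝ} (h : BigOP μ R r) (hr : Tendsto r atTop (𝓝 0)) {c : ℝ}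
    (hc : 0 < c) : WithProbTendingToOne μ fun n ω => R n ω ≤ ENNReal.ofReal c := by
  refine ENNReal.tendsto_nhds_zero.2 fun ε hε => ?_
  -- The given `ε` may be infinite; a finite positive `ε'` below it is used instead.
  obtain ⟨ε', hε'0, hε'⟩ := ENNReal.lt_iff_exists_nnreal_btwn.1 hε
  obtain ⟨M, hM⟩ := h ε' (by exact_mod_cast hε'0)
  have hMr : ∀ᶠ n in atTop, M * r n < c := by
    have : Tendsto (fun n => M * r n) atTop (𝓝 0) := by simpa using hr.const_mul M
    exact this.eventually_lt_const hc
  filter_upwards [hM, hMr] with n h1 h2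
  refine (measure_mono fun ω hω => ?_).trans (h1.trans (by simpa using hε'.le))
  exact (ENNReal.ofReal_le_ofReal h2.le).trans_lt (not_le.1 hω)

section EnormBounds

variable {V : Type*} [NormedAddCommGroup V]

theorem norm_le_of_enorm_le_ofReal {v : V} {c : ℝ} (hc : 0 ≤ c) (h : ‖v‖ₑ ≤ ENNReal.ofReal c) :
    ‖v‖ ≤ c := by
  rwa [← ofReal_norm, ENNReal.ofReal_le_ofReal_iff hc] at h

theorem enorm_le_ofReal_of_norm_le {v : V} {c : ℝ} (h : ‖v‖ ≤ c) : ‖v‖ₑ ≤ ENNReal.ofReal c := by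
  rw [← ofReal_norm]
  exact ENNReal.ofReal_le_ofReal h

theorem norm_le_of_biSup_enorm_le {α : Type*} {S : Set α} {F : α → V} {c : ℝ} (hc : 0 ≤ c)
    (h : ⨆ a ∈ S, ‖F a‖ₑ ≤ ENNReal.ofReal c) {a : α} (ha : a ∈ S) : ‖F a‖ ≤ c :=
  norm_le_of_enorm_le_ofReal hc ((le_iSup₂ (f := fun a (_ : a ∈ S) => ‖F a‖ₑ) a ha).trans h)

theorem norm_le_of_biSup_biSup_enorm_le {α β : Type*} {S : Set α} {T : Set β} {F : α → β → V}
    {c : ℝ} (hc : 0 ≤ c) (h : ⨆ a ∈ S, ⨆ b ∈ T, ‖F a b‖ₑ ≤ ENNReal.ofReal c) {a : α} (ha : a ∈ S)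
    {b : β} (hb : b ∈ T) : ‖F a b‖ ≤ c :=
  norm_le_of_biSup_enorm_le hc
    ((le_iSup₂ (f := fun a (_ : a ∈ S) => ⨆ b ∈ T, ‖F a b‖ₑ) a ha).trans h) hb

end EnormBounds

/-! ### Coordinates, segments, and regularity of curves in `z`. -/

section Calculus

theorem norm_smul_iteratedFDeriv_one_sub_le {E F : Type*} [NormedAddCommGroup E] [NormedSpace ℝ E]
    [NormedAddCommGroup F] [NormedSpace ℝ F] (f g : E → F) (c : ℝ) (x : E) :
    ‖c • iteratedFDeriv ℝ 1 f x - c • iteratedFDeriv ℝ 1 g x‖ ≤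
      ‖c • (fderiv ℝ f x - fderiv ℝ g x)‖ := by
  refine ContinuousMultilinearMap.opNorm_le_bound (norm_nonneg _) fun m => ?_
  have := (c • (fderiv ℝ f x - fderiv ℝ g x)).le_opNorm (m 0)
  simpa [iteratedFDeriv_one_apply, ← smul_sub] using this

/-- Reduces the bound on the gradient to finitely many directions, each with its own empirical
process. -/
theorem norm_le_sum_abs_single {d : ℕ} (L : EuclideanSpace ℝ (Fin d) →L[ℝ] ℝ) :
    ‖L‖ ≤ ∑ j, |L (EuclideanSpace.single j 1)| := by
  refine ContinuousLinearMap.opNorm_le_bound _ (Finset.sum_nonneg fun _ _ => abs_nonneg _)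
    fun u => ?_
  have hu : u = ∑ j, u j • EuclideanSpace.single j (1 : ℝ) := by
    have := (EuclideanSpace.basisFun (Fin d) ℝ).sum_repr u
    simpa using this.symm
  conv_lhs => rw [hu]
  rw [map_sum, Finset.sum_mul]
  refine (norm_sum_le _ _).trans (Finset.sum_le_sum fun j _ => ?_)
  rw [map_smul, norm_smul, mul_comm, Real.norm_eq_abs (L _)]
  exact mul_le_mul_of_nonneg_left (PiLp.norm_apply_le u j) (abs_nonneg _)

theorem segment_mk_subset_prod {E : Type*} [AddCommGroup E] [Module ℝ E] {S : Set E} {T : Set ℝ}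
    {x : E} {a b : ℝ} (hx : x ∈ S) (h : segment ℝ a b ⊆ T) :
    segment ℝ ((x, a) : E × ℝ) (x, b) ⊆ S ×ˢ T := by
  rintro p ⟨s, t, hs, ht, hst, rfl⟩
  refine ⟨?_, h ⟨s, t, hs, ht, hst, rfl⟩⟩
  simpa [← add_smul, hst] using hx

variable {d : ℕ} {η η' : EuclideanSpace ℝ (Fin d) → ℝ → ℝ} {N : Set (EuclideanSpace ℝ (Fin d))}
  {θ : EuclideanSpace ℝ (Fin d)}

theorem thetaDeriv_zero_apply (z : ℝ) (v : Fin 0 → EuclideanSpace ℝ (Fin d)) :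
    thetaDeriv η 0 θ z v = η θ z := rfl

theorem thetaDeriv_one_apply (z : ℝ) (v : Fin 1 → EuclideanSpace ℝ (Fin d)) :
    thetaDeriv η 1 θ z v = fderiv ℝ (fun t => η t z) θ (v 0) :=
  iteratedFDeriv_one_apply v

/-- The first `z`-derivative is continuous because the second one exists; with total order at most
three this leaves room for `s ≤ 1`. -/
theorem MixedDerivsExist.contDiffOn_thetaDeriv (h : MixedDerivsExist η N) (hθ : θ ∈ N) {s : ℕ}
    (hs : s ≤ 1) : ContDiffOn ℝ 1 (fun z => thetaDeriv η s θ z) (Icc 0 1) := by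
  rw [contDiffOn_one_iff_derivWithin (uniqueDiffOn_Icc zero_lt_one)]
  have h0 := h.2 θ hθ 0 s (by omega)
  have h1 := h.2 θ hθ 1 s (by omega)
  rw [iteratedDerivWithin_zero] at h0
  refine ⟨h0, (h1.continuousOn).congr fun z hz => ?_⟩
  rw [iteratedDerivWithin_one]

/-- The difference of the `θ`-derivatives of two curves, in a fixed direction, as a function
of `z`. -/
theorem MixedDerivsExist.contDiffOn_sub_apply (h : MixedDerivsExist η N)
    (h' : MixedDerivsExist η' N) (hθ : θ ∈ N) {s : ℕ} (hs : s ≤ 1)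
    {v : Fin s → EuclideanSpace ℝ (Fin d)} (hv : ∀ i, ‖v i‖ ≤ 1) {B : ℝ}
    (hB : ∀ z ∈ Icc (0 : ℝ) 1, ‖thetaDeriv η' s θ z - thetaDeriv η s θ z‖ ≤ B)
    (hB' : ∀ z ∈ Icc (0 : ℝ) 1, ‖derivWithin (fun u => thetaDeriv η' s θ u) (Icc 0 1) z -
      derivWithin (fun u => thetaDeriv η s θ u) (Icc 0 1) z‖ ≤ B) :
    ContDiffOn ℝ 1 (fun z => thetaDeriv η' s θ z v - thetaDeriv η s θ z v) (Icc 0 1) ∧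
    (∀ z ∈ Icc (0 : ℝ) 1, |thetaDeriv η' s θ z v - thetaDeriv η s θ z v| ≤ B) ∧
    ∀ z ∈ Icc (0 : ℝ) 1,
      |derivWithin (fun z => thetaDeriv η' s θ z v - thetaDeriv η s θ z v) (Icc 0 1) z| ≤ B := by
  have hc := h.contDiffOn_thetaDeriv hθ hs
  have hc' := h'.contDiffOn_thetaDeriv hθ hs
  -- Evaluation at `v` is continuous and linear, so it commutes with differentiation in `z`, and its
  -- norm is at most one.
  set L := ContinuousMultilinearMap.apply ℝ (fun _ : Fin s => EuclideanSpace ℝ (Fin d)) ℝ v with hL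
  have hbd : ∀ T : ContinuousMultilinearMap ℝ (fun _ : Fin s => EuclideanSpace ℝ (Fin d)) ℝ,
      |T v| ≤ ‖T‖ := fun T => by
    refine (T.le_opNorm v).trans (mul_le_of_le_one_right (norm_nonneg _) ?_)
    exact Finset.prod_le_one (fun _ _ => norm_nonneg _) fun i _ => hv i
  refine ⟨L.contDiff.comp_contDiffOn hc' |>.sub (L.contDiff.comp_contDiffOn hc),
    fun z hz => (hbd (thetaDeriv η' s θ z - thetaDeriv η s θ z)).trans (hB z hz), fun z hz => ?_⟩
  have hd := (hc.differentiableOn one_ne_zero z hz).hasDerivWithinAt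
  have hd' := (hc'.differentiableOn one_ne_zero z hz).hasDerivWithinAt
  have hdd := L.hasFDerivAt.comp_hasDerivWithinAt z (hd'.sub hd)
  have heq := hdd.derivWithin (uniqueDiffOn_Icc zero_lt_one z hz)
  have : derivWithin (fun z => thetaDeriv η' s θ z v - thetaDeriv η s θ z v) (Icc 0 1) z =
      L (derivWithin (fun u => thetaDeriv η' s θ u) (Icc 0 1) z -
        derivWithin (fun u => thetaDeriv η s θ u) (Icc 0 1) z) := heq
  rw [this]
  exact (hbd _).trans (hB' z hz)

end Calculus

/-! ### Derivatives of the log-likelihood along a curve. -/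

namespace CondParamModel

section Profile

set_option maxSynthPendingDepth 3

variable {d : ℕ} {𝒴 𝒲 : Type*} [MeasurableSpace 𝒴] [MeasurableSpace 𝒲]
  {M : CondParamModel d 𝒴 𝒲} {A : 𝒴 × (𝒲 × unitInterval) → ℝ}
  {N : Set (EuclideanSpace ℝ (Fin d))}

/-- The derivative of `θ ↦ log lik(x; θ, q θ)`. -/
def scoreAlong (M : CondParamModel d 𝒴 𝒲) (x : 𝒴 × (𝒲 × unitInterval))
    (q : EuclideanSpace ℝ (Fin d) → ℝ) (θ : EuclideanSpace ℝ (Fin d)) :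
    EuclideanSpace ℝ (Fin d) →L[ℝ] ℝ :=
  (fderiv ℝ (M.logDensity x) (θ, q θ)).comp
    ((ContinuousLinearMap.id ℝ (EuclideanSpace ℝ (Fin d))).prod (fderiv ℝ q θ))

/-- The second derivative of `θ ↦ log lik(x; θ, q θ)`. -/
def hessianAlong (M : CondParamModel d 𝒴 𝒲) (x : 𝒴 × (𝒲 × unitInterval))
    (q : EuclideanSpace ℝ (Fin d) → ℝ) (θ : EuclideanSpace ℝ (Fin d)) :
    EuclideanSpace ℝ (Fin d) →L[ℝ] EuclideanSpace ℝ (Fin d) →L[ℝ] ℝ :=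
  secondFDerivComp (fderiv ℝ (M.logDensity x) (θ, q θ))
    (fderiv ℝ (fderiv ℝ (M.logDensity x)) (θ, q θ))
    ((ContinuousLinearMap.id ℝ (EuclideanSpace ℝ (Fin d))).prod (fderiv ℝ q θ))
    ((inrComp (EuclideanSpace ℝ (Fin d))).comp (fderiv ℝ (fderiv ℝ q) θ))

theorem IsRegularAt.exists_hasThreeFDerivOn {x : 𝒴 × (𝒲 × unitInterval)} (h : M.IsRegularAt A x)
    (hN : IsOpen N) (hNΘ : N ⊆ interior M.Θ) {q : EuclideanSpace ℝ (Fin d) → ℝ}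
    (hq : ThriceDifferentiableOn q N) (hqH : ∀ θ ∈ N, q θ ∈ interior M.H) :
    ∃ f₃, HasThreeFDerivOn (fun θ => M.loglik x θ (q θ)) (M.scoreAlong x q) (M.hessianAlong x q)
      f₃ N ∧ ∀ θ ∈ N, ∀ C, ‖fderiv ℝ q θ‖ ≤ C → ‖fderiv ℝ (fderiv ℝ q) θ‖ ≤ C →
        ‖fderiv ℝ (fderiv ℝ (fderiv ℝ q)) θ‖ ≤ C → ‖f₃ θ‖ ≤ A x * (5 * (1 + C) ^ 3) := by
  have hmaps : MapsTo (fun θ => (θ, q θ)) N (interior M.Θ ×ˢ interior M.H) :=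
    fun θ hθ => ⟨hNΘ hθ, hqH θ hθ⟩
  obtain ⟨f₃, hf₃, hn⟩ := h.hasThreeFDerivOn.comp
    (hasThreeFDerivOn_of_differentiableOn hN hq).graph hmaps
  refine ⟨f₃, hf₃, fun θ hθ C h1 h2 h3 => (hn θ hθ).trans ?_⟩
  exact norm_comp_graph_third_le (h.norm_first_le (hmaps hθ)) (h.norm_second_le (hmaps hθ))
    (h.norm_third_le (hmaps hθ)) h1 h2 h3

/-- The first three derivatives of the log-likelihood along a curve. -/
theorem exists_hasThreeFDerivOn_profile {n : ℕ} {x : ℕ → 𝒴 × (𝒲 × unitInterval)}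
    (h : ∀ i, M.IsRegularAt A (x i)) (hN : IsOpen N) (hNΘ : N ⊆ interior M.Θ)
    {η : EuclideanSpace ℝ (Fin d) → ℝ → ℝ}
    (hη : ∀ z ∈ Icc (0 : ℝ) 1, ThriceDifferentiableOn (fun θ => η θ z) N)
    (hηH : ∀ θ ∈ N, η θ ∈ M.nuisanceSpace) :
    ∃ f₃, HasThreeFDerivOn (M.profile n x η)
      (fun θ => ∑ i ∈ Finset.range n, M.scoreAlong (x i) (fun t => η t (x i).2.2) θ)
      (fun θ => ∑ i ∈ Finset.range n, M.hessianAlong (x i) (fun t => η t (x i).2.2) θ) f₃ N ∧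
      ∀ θ ∈ N, ∀ C, (∀ s, 1 ≤ s → s ≤ 3 → ∀ z ∈ Icc (0 : ℝ) 1, ‖thetaDeriv η s θ z‖ ≤ C) →
        ‖f₃ θ‖ ≤ (∑ i ∈ Finset.range n, |A (x i)|) * (5 * (1 + C) ^ 3) := by
  choose f₃ hf₃ hn using fun i => (h i).exists_hasThreeFDerivOn hN hNΘ (hη _ (x i).2.2.2)
    fun θ hθ => (hηH θ hθ).2 _ (x i).2.2.2
  refine ⟨_, HasThreeFDerivOn.sum fun i _ => hf₃ i, fun θ hθ C hC => ?_⟩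
  rw [Finset.sum_mul]
  refine (norm_sum_le _ _).trans (Finset.sum_le_sum fun i _ => ?_)
  have hq := hasThreeFDerivOn_of_differentiableOn hN (hη _ (x i).2.2.2)
  have hC1 : ‖fderiv ℝ (fun t => η t (x i).2.2) θ‖ ≤ C := by
    rw [← hq.norm_iteratedFDeriv_one hθ]
    exact hC 1 le_rfl (by norm_num) _ (x i).2.2.2
  have hC0 : 0 ≤ C := (norm_nonneg _).trans hC1
  refine (hn i θ hθ C hC1 ?_ ?_).trans (mul_le_mul_of_nonneg_right (le_abs_self _) (by positivity))
  · rw [← hq.norm_iteratedFDeriv_two hN hθ]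
    exact hC 2 (by norm_num) (by norm_num) _ (x i).2.2.2
  · rw [← hq.norm_iteratedFDeriv_three hN hθ]
    exact hC 3 (by norm_num) (by norm_num) _ (x i).2.2.2

/-- A neighborhood of `θ₀` on which all curves close to `ηs` can be joined to it inside `H`. -/
theorem exists_isOpen_forall_segment_subset {θ₀ : EuclideanSpace ℝ (Fin d)} (hN : IsOpen N)
    (hθ₀ : θ₀ ∈ N) {ηs : EuclideanSpace ℝ (Fin d) → ℝ → ℝ}
    (hηs : ∀ θ ∈ N, ηs θ ∈ M.nuisanceSpace)
    (hdiff : ∀ z ∈ Icc (0 : ℝ) 1, ∀ θ ∈ N, DifferentiableAt ℝ (fun t => ηs t z) θ) {C : ℝ}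
    (hC : ∀ θ ∈ N, ∀ z ∈ Icc (0 : ℝ) 1, ‖fderiv ℝ (fun t => ηs t z) θ‖ ≤ C) :
    ∃ N' ⊆ N, IsOpen N' ∧ θ₀ ∈ N' ∧ (M.H.OrdConnected → N' = N) ∧ ∃ ρ > 0,
      ∀ η : EuclideanSpace ℝ (Fin d) → ℝ → ℝ, (∀ θ ∈ N, η θ ∈ M.nuisanceSpace) →
        (∀ θ ∈ N, ∀ z ∈ Icc (0 : ℝ) 1, |η θ z - ηs θ z| ≤ ρ) →
        ∀ θ ∈ N', ∀ z ∈ Icc (0 : ℝ) 1, segment ℝ (ηs θ z) (η θ z) ⊆ interior M.H := by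
  by_cases hH : M.H.OrdConnected
  · refine ⟨N, subset_rfl, hN, hθ₀, fun _ => rfl, 1, one_pos, fun η hη _ θ hθ z hz => ?_⟩
    -- For an interval, the interior is convex and closeness of the curves plays no role, so the
    -- radius 1 above is arbitrary.
    exact hH.convex.interior.segment_subset ((hηs θ hθ).2 z hz) ((hη θ hθ).2 z hz)
  obtain ⟨ρ, hρ, hρH⟩ := M.exists_forall_abs_sub_lt_mem_interior (hηs θ₀ hθ₀)
  obtain ⟨r, hr, hrN⟩ := Metric.isOpen_iff.1 hN θ₀ hθ₀
  have hC0 : 0 ≤ C := (norm_nonneg _).trans (hC θ₀ hθ₀ 0 (by simp))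
  -- Half of `ρ` pays for moving `ηs` from `θ₀` to `θ`, by the Lipschitz constant `C`, and the other
  -- half for the distance between the two curves.
  refine ⟨Metric.ball θ₀ (min r (ρ / (2 * (C + 1)))),
    (Metric.ball_subset_ball (min_le_left _ _)).trans hrN, Metric.isOpen_ball,
    Metric.mem_ball_self (by positivity), fun h => absurd h hH, ρ / 2, by positivity,
    fun η _ hηρ θ hθ z hz l hl => ?_⟩
  have hθ1 : θ ∈ Metric.ball θ₀ r := Metric.ball_subset_ball (min_le_left _ _) hθ
  have hθ2 : ‖θ - θ₀‖ < ρ / (2 * (C + 1)) := by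
    rw [← mem_ball_iff_norm]
    exact Metric.ball_subset_ball (min_le_right _ _) hθ
  have h1 : ‖ηs θ z - ηs θ₀ z‖ ≤ C * ‖θ - θ₀‖ :=
    (convex_ball θ₀ r).norm_image_sub_le_of_norm_fderiv_le (𝕜 := ℝ) (f := fun t => ηs t z)
      (fun t ht => hdiff z hz t (hrN ht)) (fun t ht => hC t (hrN ht) z hz)
      (Metric.mem_ball_self hr) hθ1
  have h2 : C * ‖θ - θ₀‖ < ρ / 2 := by
    rw [lt_div_iff₀ (by positivity)] at hθ2
    nlinarith [norm_nonneg (θ - θ₀)]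
  have h3 : |l - ηs θ z| ≤ ρ / 2 := by
    obtain ⟨t, ht, rfl⟩ := (segment_eq_image' ℝ (ηs θ z) (η θ z)).subset hl
    rw [add_sub_cancel_left, smul_eq_mul, abs_mul, abs_of_nonneg ht.1]
    exact (mul_le_of_le_one_left (abs_nonneg _) ht.2).trans (hηρ θ (hrN hθ1) z hz)
  refine hρH z hz l ?_
  have : l - ηs θ₀ z = (l - ηs θ z) + (ηs θ z - ηs θ₀ z) := by ring
  rw [this]
  refine (abs_add_le _ _).trans_lt ?_
  rw [Real.norm_eq_abs] at h1
  linarith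

end Profile

end CondParamModel

theorem norm_single_one_le {d : ℕ} (j : Fin d) :
    ‖(EuclideanSpace.single j 1 : EuclideanSpace ℝ (Fin d))‖ ≤ 1 := by
  simp

/-! ### Expansions along two curves, and empirical bounds for the scores. -/

namespace CondParamModel

section Rates

set_option maxSynthPendingDepth 3

variable {d : ℕ} {𝒴 𝒲 : Type*} [MeasurableSpace 𝒴] [MeasurableSpace 𝒲]
  {M : CondParamModel d 𝒴 𝒲} {A : 𝒴 × (𝒲 × unitInterval) → ℝ}
  {N : Set (EuclideanSpace ℝ (Fin d))}

theorem IsRegularAt.norm_hessianAlong_sub_le {x : 𝒴 × (𝒲 × unitInterval)} (h : M.IsRegularAt A x)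
    {θ : EuclideanSpace ℝ (Fin d)} (hθ : θ ∈ interior M.Θ) {q q' : EuclideanSpace ℝ (Fin d) → ℝ}
    (hseg : segment ℝ (q θ) (q' θ) ⊆ interior M.H) {C ρ : ℝ}
    (h1 : ‖iteratedFDeriv ℝ 1 q θ‖ ≤ C) (h2 : ‖iteratedFDeriv ℝ 2 q θ‖ ≤ C)
    (hd0 : |q' θ - q θ| ≤ ρ) (hd1 : ‖iteratedFDeriv ℝ 1 q' θ - iteratedFDeriv ℝ 1 q θ‖ ≤ ρ)
    (hd2 : ‖iteratedFDeriv ℝ 2 q' θ - iteratedFDeriv ℝ 2 q θ‖ ≤ ρ) :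
    ‖M.hessianAlong x q' θ - M.hessianAlong x q θ‖ ≤ |A x| * (5 * (1 + C + ρ) ^ 2) * ρ := by
  have hρ : 0 ≤ ρ := (abs_nonneg _).trans hd0
  have hC : 0 ≤ C := (norm_nonneg _).trans h1
  refine (h.hasThreeFDerivOn.norm_comp_graph_second_sub_le (abs_nonneg (A x))
    (fun p hp => (h.norm_first_le hp).trans (le_abs_self _))
    (fun p hp => (h.norm_second_le hp).trans (le_abs_self _))
    (fun p hp => (h.norm_third_le hp).trans (le_abs_self _))
    (segment_mk_subset_prod hθ hseg) ?_ ?_ hd0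
    ((norm_fderiv_sub_le_norm_iteratedFDeriv_one_sub _ _ _).trans hd1)
    ((norm_fderiv_fderiv_sub_le_norm_iteratedFDeriv_two_sub _ _ _).trans hd2))
  · rwa [← norm_iteratedFDeriv_fderiv, norm_iteratedFDeriv_zero] at h1
  · rwa [← norm_iteratedFDeriv_fderiv, ← norm_iteratedFDeriv_fderiv,
      norm_iteratedFDeriv_zero] at h2

theorem IsRegularAt.abs_scoreAlong_sub_le {x : 𝒴 × (𝒲 × unitInterval)} (h : M.IsRegularAt A x)
    {θ e : EuclideanSpace ℝ (Fin d)} (hθ : θ ∈ interior M.Θ) (he : ‖e‖ ≤ 1)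
    {q q' : EuclideanSpace ℝ (Fin d) → ℝ}
    (hseg : segment ℝ (q θ) (q' θ) ⊆ interior M.H) {C ρ : ℝ}
    (h1 : ‖iteratedFDeriv ℝ 1 q θ‖ ≤ C)
    (hd0 : |q' θ - q θ| ≤ ρ) (hd1 : ‖iteratedFDeriv ℝ 1 q' θ - iteratedFDeriv ℝ 1 q θ‖ ≤ ρ) :
    |M.scoreAlong x q' θ e - M.scoreAlong x q θ e -
      (fderiv ℝ (M.logDensity x) (θ, q θ) (0, 1) * (fderiv ℝ q' θ e - fderiv ℝ q θ e) +
        fderiv ℝ (fderiv ℝ (M.logDensity x)) (θ, q θ) (0, 1) (e, fderiv ℝ q θ e) *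
          (q' θ - q θ))| ≤ |A x| * (2 + C) * ρ ^ 2 := by
  refine h.hasThreeFDerivOn.abs_comp_graph_first_sub_le (abs_nonneg (A x))
    (fun p hp => (h.norm_second_le hp).trans (le_abs_self _))
    (fun p hp => (h.norm_third_le hp).trans (le_abs_self _))
    (segment_mk_subset_prod hθ hseg) he ?_ hd0
    ((norm_fderiv_sub_le_norm_iteratedFDeriv_one_sub _ _ _).trans hd1)
  rwa [← norm_iteratedFDeriv_fderiv, norm_iteratedFDeriv_zero] at h1

section EmpiricalScores

variable {Ω : Type*} [MeasurableSpace Ω] {θ₀ : EuclideanSpace ℝ (Fin d)} {η₀ : ℝ → ℝ}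
  [IsProbabilityMeasure (M.law θ₀ η₀)] {μ : Measure Ω} [IsProbabilityMeasure μ]
  {X : ℕ → Ω → 𝒴 × (𝒲 × unitInterval)}

theorem measurable_covariate :
    Measurable fun x : 𝒴 × (𝒲 × unitInterval) => (x.2.2 : ℝ) :=
  measurable_subtype_coe.comp (measurable_snd.comp measurable_snd)

theorem norm_zero_mk_one_le (E : Type*) [NormedAddCommGroup E] : ‖((0, 1) : E × ℝ)‖ ≤ 1 := by
  simp [Prod.norm_def]

/-- The score in the nuisance direction at the least favorable curve satisfies a uniform bound
over balls of `C¹[0,1]`. -/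
theorem IsLeastFavorableAt.exists_bigOP_score {θ : EuclideanSpace ℝ (Fin d)} {h : ℝ → ℝ}
    (hh : M.IsLeastFavorableAt θ₀ η₀ θ h) (hXm : ∀ i, Measurable (X i)) (hXind : iIndepFun X μ)
    (hXlaw : ∀ i, μ.map (X i) = M.law θ₀ η₀) (hθ : θ ∈ interior M.Θ)
    (hA : MemLp A 2 (M.law θ₀ η₀)) (hreg : ∀ᵐ x ∂(M.law θ₀ η₀), M.IsRegularAt A x) :
    ∃ W : ℕ → Ω → ℝ≥0∞, BigOP μ W (fun n => (n : ℝ) ^ (-(1 / 2) : ℝ)) ∧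
      ∀ (n : ℕ) ω (f : ℝ → ℝ) (B : ℝ), ContDiffOn ℝ 1 f (Icc 0 1) →
        (∀ u ∈ Icc (0 : ℝ) 1, |f u| ≤ B) →
        (∀ u ∈ Icc (0 : ℝ) 1, |derivWithin f (Icc 0 1) u| ≤ B) →
        ‖(1 / n : ℝ) * ∑ i ∈ Finset.range n,
          fderiv ℝ (M.logDensity (X i ω)) (θ, h (X i ω).2.2) (0, 1) * f (X i ω).2.2‖ₑ ≤
          ENNReal.ofReal B * W n ω := by
  have h0 := fun (φ : ℝ → ℝ) (hφ : ContDiff ℝ 2 φ) =>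
    hh.integral_score_mul_eq_zero hθ hA hreg hφ
  -- The test function `φ = 1` yields integrability, and in particular measurability, of the score
  -- itself.
  have hi : Integrable (fun x => fderiv ℝ (M.logDensity x) (θ, h x.2.2) (0, 1))
      (M.law θ₀ η₀) := by
    simpa using (h0 (fun _ => 1) contDiff_const).1
  refine exists_bigOP_forall_enorm_sum_mul_le hXm hXind hXlaw measurable_covariate
    (fun x => x.2.2.2) (hA.mono hi.aestronglyMeasurable ?_)
    (integral_mul_indicator_eq_zero hi measurable_covariate fun φ hφ => (h0 φ hφ).2)
  filter_upwards [hreg] with x hx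
  refine (ContinuousLinearMap.le_opNorm _ _).trans
    ((mul_le_of_le_one_right (norm_nonneg _) (norm_zero_mk_one_le _)).trans ?_)
  exact (hx.norm_first_le ⟨hθ, hh.1.2 _ x.2.2.2⟩).trans (le_abs_self _)

/-- The derivative along the least favorable curve of the score in the nuisance direction satisfies
a uniform bound over balls of `C¹[0,1]`. -/
theorem exists_bigOP_score_deriv (hXm : ∀ i, Measurable (X i)) (hXind : iIndepFun X μ)
    (hXlaw : ∀ i, μ.map (X i) = M.law θ₀ η₀) (hN : IsOpen N)
    (hθ₀ : θ₀ ∈ N) (hNΘ : N ⊆ interior M.Θ) {ηs : EuclideanSpace ℝ (Fin d) → ℝ → ℝ}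
    (hηs : ∀ θ ∈ N, M.IsLeastFavorableAt θ₀ η₀ θ (ηs θ))
    (hdiff : ∀ z ∈ Icc (0 : ℝ) 1, ∀ θ ∈ N, DifferentiableAt ℝ (fun t => ηs t z) θ) {C : ℝ}
    (hC : ∀ θ ∈ N, ∀ z ∈ Icc (0 : ℝ) 1, ‖fderiv ℝ (fun t => ηs t z) θ‖ ≤ C)
    (hA : MemLp A 2 (M.law θ₀ η₀)) (hreg : ∀ᵐ x ∂(M.law θ₀ η₀), M.IsRegularAt A x)
    (e : EuclideanSpace ℝ (Fin d)) (he : ‖e‖ ≤ 1) :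
    ∃ W : ℕ → Ω → ℝ≥0∞, BigOP μ W (fun n => (n : ℝ) ^ (-(1 / 2) : ℝ)) ∧
      ∀ (n : ℕ) ω (f : ℝ → ℝ) (B : ℝ), ContDiffOn ℝ 1 f (Icc 0 1) →
        (∀ u ∈ Icc (0 : ℝ) 1, |f u| ≤ B) →
        (∀ u ∈ Icc (0 : ℝ) 1, |derivWithin f (Icc 0 1) u| ≤ B) →
        ‖(1 / n : ℝ) * ∑ i ∈ Finset.range n,
          fderiv ℝ (fderiv ℝ (M.logDensity (X i ω))) (θ₀, ηs θ₀ (X i ω).2.2) (0, 1)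
            (e, fderiv ℝ (fun t => ηs t (X i ω).2.2) θ₀ e) * f (X i ω).2.2‖ₑ ≤
          ENNReal.ofReal B * W n ω := by
  have h0 := fun (φ : ℝ → ℝ) (hφ : ContDiff ℝ 2 φ) =>
    integral_score_deriv_mul_eq_zero hN hθ₀ hNΘ hηs hdiff hC hA hreg e hφ
  have hi : Integrable (fun x => fderiv ℝ (fderiv ℝ (M.logDensity x)) (θ₀, ηs θ₀ x.2.2) (0, 1)
      (e, fderiv ℝ (fun t => ηs t x.2.2) θ₀ e)) (M.law θ₀ η₀) := by
    simpa using (h0 (fun _ => 1) contDiff_const).1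
  have hC0 : 0 ≤ C := (norm_nonneg _).trans (hC θ₀ hθ₀ 0 (by simp))
  refine exists_bigOP_forall_enorm_sum_mul_le hXm hXind hXlaw measurable_covariate
    (fun x => x.2.2.2) ((hA.mul_const (1 + C)).mono hi.aestronglyMeasurable ?_)
    (integral_mul_indicator_eq_zero hi measurable_covariate fun φ hφ => (h0 φ hφ).2)
  filter_upwards [hreg] with x hx
  have hp : (θ₀, ηs θ₀ x.2.2) ∈ interior M.Θ ×ˢ interior M.H :=
    ⟨hNΘ hθ₀, (hηs θ₀ hθ₀).1.2 _ x.2.2.2⟩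
  have n2 : ‖fderiv ℝ (fun t => ηs t x.2.2) θ₀ e‖ ≤ C :=
    (ContinuousLinearMap.le_opNorm _ _).trans
      ((mul_le_of_le_one_right (norm_nonneg _) he).trans (hC _ hθ₀ _ x.2.2.2))
  have n3 : ‖((e, fderiv ℝ (fun t => ηs t x.2.2) θ₀ e) : EuclideanSpace ℝ (Fin d) × ℝ)‖ ≤ 1 + C :=
    max_le (by linarith) (by linarith)
  have n4 : ‖fderiv ℝ (fderiv ℝ (M.logDensity x)) (θ₀, ηs θ₀ x.2.2) (0, 1)‖ ≤ |A x| :=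
    (ContinuousLinearMap.le_opNorm _ _).trans
      ((mul_le_of_le_one_right (norm_nonneg _) (norm_zero_mk_one_le _)).trans
        ((hx.norm_second_le hp).trans (le_abs_self _)))
  rw [norm_mul, Real.norm_eq_abs (A x), Real.norm_of_nonneg (by linarith : 0 ≤ 1 + C)]
  exact (ContinuousLinearMap.le_opNorm _ _).trans (mul_le_mul n4 n3 (norm_nonneg _) (abs_nonneg _))

end EmpiricalScores

end Rates

end CondParamModel

end

/-! ### The main theorem. -/

set_option maxHeartbeats 1000000 in
set_option maxSynthPendingDepth 3 in
theorem theorem4 {d : ℕ} {𝒴 𝒲 Ω : Type*} [MeasurableSpace 𝒴] [MeasurableSpace 𝒲]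
    [MeasurableSpace Ω] (M : CondParamModel d 𝒴 𝒲)
    (θ₀ : EuclideanSpace ℝ (Fin d)) (η₀ : ℝ → ℝ) (hη₀ : η₀ ∈ M.nuisanceSpace)
    (μ : Measure Ω) [IsProbabilityMeasure μ]
    (X : ℕ → Ω → 𝒴 × (𝒲 × unitInterval)) (hX : M.IsSample θ₀ η₀ μ X)
    (K : ℝ → ℝ) (hK : IsKernel K)
    (b : ℕ → ℝ) (hb_pos : ∀ n, 0 < b n) (hb : Tendsto b atTop (𝓝 0))
    (N : Set (EuclideanSpace ℝ (Fin d))) (hN : IsOpen N) (hθ₀ : θ₀ ∈ N) (hNΘ : N ⊆ M.Θ)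
    (ηs : EuclideanSpace ℝ (Fin d) → ℝ → ℝ)
    (hηs : ∀ θ ∈ N, M.IsLeastFavorableAt θ₀ η₀ θ (ηs θ))
    (ηh : ℕ → Ω → EuclideanSpace ℝ (Fin d) → ℝ → ℝ)
    (hηh : WithProbTendingToOne μ fun n ω =>
      ∀ θ ∈ N, M.IsKernelEstimateAt K (b n) n (fun i => X i ω) θ (ηh n ω θ))
    (hK1 : M.ConditionK1) (hK2 : M.ConditionK2 θ₀ η₀)
    (g δ : ℝ) (hC1 : ConditionC1 μ ηs ηh N) (hC2 : ConditionC2 μ ηs ηh θ₀ N g δ) :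
    ∃ N' ⊆ N, IsOpen N' ∧ θ₀ ∈ N' ∧ (M.H.OrdConnected → N' = N) ∧
      ConditionG μ
        (fun n ω => M.profile n (fun i => X i ω) (ηh n ω))
        (fun n ω => M.profile n (fun i => X i ω) ηs) θ₀ N' g := by
  obtain ⟨hXm, hXind, hXlaw⟩ := hX
  obtain ⟨hs_diff, hh_diff, hs_bdd⟩ := hC1
  obtain ⟨⟨hg1, hg2⟩, ⟨hδ1, hδ2⟩, hD, hD3, hE⟩ := hC2
  have hNi : N ⊆ interior M.Θ := interior_maximal hNΘ hN
  have : IsProbabilityMeasure (M.law θ₀ η₀) := by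
    rw [← hXlaw 0]
    exact Measure.isProbabilityMeasure_map (hXm 0).aemeasurable
  obtain ⟨A, hA2, hreg⟩ := hK2.exists_isRegularAt
  -- a common bound for the derivatives of the least favorable curve
  obtain ⟨C, hC⟩ : ∃ C : ℝ, ∀ s ≤ 3, ∀ θ ∈ N, ∀ z ∈ Icc (0 : ℝ) 1, ‖thetaDeriv ηs s θ z‖ ≤ C := by
    have h' : ∀ s : Fin 4, ∃ C : ℝ, ∀ θ ∈ N, ∀ z ∈ Icc (0 : ℝ) 1,
        ‖thetaDeriv ηs s θ z‖ ≤ C := fun s => hs_bdd s (by omega)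
    choose c hc using h'
    refine ⟨∑ s, |c s|, fun s hs θ hθ z hz => (hc ⟨s, by omega⟩ θ hθ z hz).trans ?_⟩
    exact (le_abs_self _).trans (Finset.single_le_sum (f := fun s => |c s|)
      (fun _ _ => abs_nonneg _) (Finset.mem_univ _))
  have hC0 : 0 ≤ C := (norm_nonneg _).trans (hC 0 (by norm_num) θ₀ hθ₀ 0 (by simp))
  have hCf : ∀ θ ∈ N, ∀ z ∈ Icc (0 : ℝ) 1, ‖fderiv ℝ (fun t => ηs t z) θ‖ ≤ C := by
    intro θ hθ z hz
    have := hC 1 (by norm_num) θ hθ z hz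
    rwa [thetaDeriv, ← norm_iteratedFDeriv_fderiv, norm_iteratedFDeriv_zero] at this
  have hs_d1 : ∀ z ∈ Icc (0 : ℝ) 1, ∀ θ ∈ N, DifferentiableAt ℝ (fun t => ηs t z) θ :=
    fun z hz θ hθ =>
      ((hasThreeFDerivOn_of_differentiableOn hN (hs_diff.1 z hz)).first θ hθ).differentiableAt
  obtain ⟨N', hN'N, hN'o, hθ₀', hN'eq, ρ, hρ, hseg⟩ :=
    CondParamModel.exists_isOpen_forall_segment_subset hN hθ₀ (fun θ hθ => (hηs θ hθ).1) hs_d1 hCf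
  refine ⟨N', hN'N, hN'o, hθ₀', hN'eq, ⟨hg1, hg2⟩, ?_⟩
  -- rates
  set rg : ℕ → ℝ := fun n => (n : ℝ) ^ (-g) with hrg
  set rδ : ℕ → ℝ := fun n => (n : ℝ) ^ (-δ) with hrδ
  set rh : ℕ → ℝ := fun n => (n : ℝ) ^ (-(1 / 2) : ℝ) with hrh
  have hrg0 : ∀ n, 0 ≤ rg n := fun n => Real.rpow_nonneg (Nat.cast_nonneg n) _
  have hrδ0 : ∀ n, 0 ≤ rδ n := fun n => Real.rpow_nonneg (Nat.cast_nonneg n) _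
  have hrh0 : ∀ n, 0 ≤ rh n := fun n => Real.rpow_nonneg (Nat.cast_nonneg n) _
  have hrg_lim : Tendsto rg atTop (𝓝 0) :=
    (tendsto_rpow_neg_atTop (by linarith)).comp tendsto_natCast_atTop_atTop
  have hrg1 : ∀ n, 1 ≤ n → rg n ≤ 1 := fun n hn =>
    Real.rpow_le_one_of_one_le_of_nonpos (by exact_mod_cast hn) (by linarith)
  -- Since `δ ≤ g`, the errors of the curve values also fit the slower rate of their
  -- `z`-derivatives, which gives a common `C¹` radius.
  have hrgδ : ∀ n, 1 ≤ n → rg n ≤ rδ n := fun n hn =>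
    Real.rpow_le_rpow_of_exponent_le (by exact_mod_cast hn) (by linarith)
  have hrgg : ∀ n, 1 ≤ n → rg n ^ 2 = (n : ℝ) ^ (-(2 * g)) := fun n hn => by
    rw [hrg, ← Real.rpow_natCast, ← Real.rpow_mul (Nat.cast_nonneg n)]
    congr 1
    push_cast
    ring
  -- This is where `δ ≥ 2g - 1/2` enters.
  have hrδh : ∀ n, 1 ≤ n → rδ n * rh n ≤ (n : ℝ) ^ (-(2 * g)) := fun n hn => by
    rw [hrδ, hrh, ← Real.rpow_add (by exact_mod_cast hn)]
    exact Real.rpow_le_rpow_of_exponent_le (by exact_mod_cast hn) (by linarith)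
  -- the event on which everything is deterministic
  set D : ℕ → ℕ → Ω → ℝ≥0∞ := fun s n ω => ⨆ θ ∈ N, ⨆ z ∈ Icc (0 : ℝ) 1,
    ‖thetaDeriv (ηh n ω) s θ z - thetaDeriv ηs s θ z‖ₑ with hDdef
  set E : ℕ → ℕ → Ω → ℝ≥0∞ := fun s n ω => ⨆ z ∈ Icc (0 : ℝ) 1,
      ‖derivWithin (fun u => thetaDeriv (ηh n ω) s θ₀ u) (Icc 0 1) z -
        derivWithin (fun u => thetaDeriv ηs s θ₀ u) (Icc 0 1) z‖ₑ with hEdef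
  set V : ℕ → Ω → ℝ≥0∞ := fun n ω =>
    ENNReal.ofReal ((1 / n : ℝ) * ∑ i ∈ Finset.range n, |A (X i ω)|) with hVdef
  have hV : BigOP μ V fun _ => 1 := bigOP_average hXm hXlaw (hA2.integrable (by norm_num))
  have hDb : ∀ {s n ω c}, 0 ≤ c → D s n ω ≤ ENNReal.ofReal c → ∀ θ ∈ N, ∀ z ∈ Icc (0 : ℝ) 1,
      ‖thetaDeriv (ηh n ω) s θ z - thetaDeriv ηs s θ z‖ ≤ c :=
    fun hc h θ hθ z hz => norm_le_of_biSup_biSup_enorm_le hc h hθ hz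
  have hDb0 : ∀ {n ω c}, 0 ≤ c → D 0 n ω ≤ ENNReal.ofReal c → ∀ θ ∈ N, ∀ z ∈ Icc (0 : ℝ) 1,
      |ηh n ω θ z - ηs θ z| ≤ c := by
    intro n ω c hc h θ hθ z hz
    refine le_trans ?_ (hDb hc h θ hθ z hz)
    exact (thetaDeriv (ηh n ω) 0 θ z - thetaDeriv ηs 0 θ z).le_opNorm 0 |>.trans (by simp)
  have hVb : ∀ {n ω c}, 0 ≤ c → V n ω ≤ ENNReal.ofReal (c * 1) →
      (1 / n : ℝ) * ∑ i ∈ Finset.range n, |A (X i ω)| ≤ c := by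
    intro n ω c hc h
    rwa [mul_one, hVdef, ENNReal.ofReal_le_ofReal_iff hc] at h
  set G : ℕ → Ω → Prop := fun n ω => (MixedDerivsExist (ηh n ω) N ∧
    (∀ θ ∈ N, ηh n ω θ ∈ M.nuisanceSpace)) ∧ (∀ i, M.IsRegularAt A (X i ω)) ∧
    D 0 n ω ≤ ENNReal.ofReal ρ with hGdef
  have hG : WithProbTendingToOne μ G := by
    refine (hh_diff.and (hηh.mono_ae (Eventually.of_forall fun n => Eventually.of_forall
      fun ω h θ hθ => (h θ hθ).1))).and (WithProbTendingToOne.and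
        (withProbTendingToOne_of_ae ?_) ((hD 0 (by norm_num)).withProbTendingToOne_le hrg_lim hρ))
    have : ∀ᵐ ω ∂μ, ∀ i, M.IsRegularAt A (X i ω) := by
      refine ae_all_iff.2 fun i => ?_
      have h : ∀ᵐ x ∂(μ.map (X i)), M.IsRegularAt A x := by rw [hXlaw i]; exact hreg
      exact ae_of_ae_map (hXm i).aemeasurable h
    exact this.mono fun ω h _ => h
  have hGseg : ∀ {n ω}, G n ω → ∀ θ ∈ N', ∀ z ∈ Icc (0 : ℝ) 1,
      segment ℝ (ηs θ z) (ηh n ω θ z) ⊆ interior M.H :=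
    fun h => hseg _ h.1.2 (hDb0 hρ.le h.2.2)
  have hPh : ∀ {n ω}, G n ω → _ := fun {n ω} (h : G n ω) =>
    CondParamModel.exists_hasThreeFDerivOn_profile (n := n) h.2.1 hN hNi h.1.1.1 h.1.2
  have hPs : ∀ {n ω}, G n ω → _ := fun {n ω} (h : G n ω) =>
    CondParamModel.exists_hasThreeFDerivOn_profile (n := n) h.2.1 hN hNi hs_diff.1
      fun θ hθ => (hηs θ hθ).1
  refine ⟨?_, ?_, ?_, ?_⟩
  · refine hG.mono_ae (Eventually.of_forall fun n => Eventually.of_forall fun ω h => ?_)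
    obtain ⟨_, hh, -⟩ := hPh h
    obtain ⟨_, hs, -⟩ := hPs h
    exact ⟨fun k hk => (hh.differentiableOn_iteratedFDeriv hN hk).mono hN'N,
      fun k hk => (hs.differentiableOn_iteratedFDeriv hN hk).mono hN'N⟩
  · -- first derivative
    obtain ⟨W, hW, hWb⟩ := (hηs θ₀ hθ₀).exists_bigOP_score hXm hXind hXlaw (hNi hθ₀) hA2 hreg
    choose U hU hUb using fun j => CondParamModel.exists_bigOP_score_deriv hXm hXind hXlaw hN hθ₀
      hNi hηs hs_d1 hCf hA2 hreg (EuclideanSpace.single j 1) (norm_single_one_le j)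
    -- The score in `λ` needs one empirical process, `W`; its derivative along the curve needs one
    -- per coordinate direction, `U j`.
    refine BigOP.of_forall (ι := Fin 6 ⊕ Fin d)
      (R := Sum.elim ![D 0, D 1, E 0, E 1, V, W] U)
      (r := Sum.elim ![rg, rg, rδ, rδ, fun _ => 1, rh] fun _ => rh) ?_ ?_ hG fun B hB => ?_
    · rintro (j | j) n
      · fin_cases j
        exacts [hrg0 n, hrg0 n, hrδ0 n, hrδ0 n, zero_le_one, hrh0 n]
      · exact hrh0 n
    · rintro (j | j)
      · fin_cases j
        exacts [hD 0 (by norm_num), hD 1 (by norm_num), (hE 0 (by norm_num)).bigOP,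
          (hE 1 (by norm_num)).bigOP, hV, hW]
      · exact hU j
    -- Per coordinate, each of the two empirical terms contributes `B²` (ball radius times process),
    -- and the quadratic remainder `(2 + C) B²` is multiplied by the averaged envelope, at most `B`.
    -- The sum over coordinates gives `d`.
    refine ⟨d * (2 * B ^ 2 + (2 + C) * B ^ 3), ?_⟩
    filter_upwards [eventually_ge_atTop 1] with n hn ω hGω hR
    have hD0 : D 0 n ω ≤ ENNReal.ofReal (B * rg n) := hR (Sum.inl 0)
    have hD1 : D 1 n ω ≤ ENNReal.ofReal (B * rg n) := hR (Sum.inl 1)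
    have hE0 : E 0 n ω ≤ ENNReal.ofReal (B * rδ n) := hR (Sum.inl 2)
    have hE1 : E 1 n ω ≤ ENNReal.ofReal (B * rδ n) := hR (Sum.inl 3)
    have hVn := hVb hB (hR (Sum.inl 4))
    have hWn : W n ω ≤ ENNReal.ofReal (B * rh n) := hR (Sum.inl 5)
    have hUn : ∀ j, U j n ω ≤ ENNReal.ofReal (B * rh n) := fun j => hR (Sum.inr j)
    have hBg : 0 ≤ B * rg n := mul_nonneg hB (hrg0 n)
    have hBδ : 0 ≤ B * rδ n := mul_nonneg hB (hrδ0 n)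
    have hgδ : B * rg n ≤ B * rδ n := mul_le_mul_of_nonneg_left (hrgδ n hn) hB
    obtain ⟨_, hh, -⟩ := hPh hGω
    obtain ⟨_, hs, -⟩ := hPs hGω
    set a : 𝒴 × (𝒲 × unitInterval) → ℝ :=
      fun x => fderiv ℝ (M.logDensity x) (θ₀, ηs θ₀ x.2.2) (0, 1) with ha
    set m : Fin d → 𝒴 × (𝒲 × unitInterval) → ℝ := fun j x =>
      fderiv ℝ (fderiv ℝ (M.logDensity x)) (θ₀, ηs θ₀ x.2.2) (0, 1)
        (EuclideanSpace.single j 1, fderiv ℝ (fun t => ηs t x.2.2) θ₀ (EuclideanSpace.single j 1))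
      with hm
    have key : ∀ j, |(1 / n : ℝ) * (fderiv ℝ (M.profile n (fun i => X i ω) (ηh n ω)) θ₀ -
        fderiv ℝ (M.profile n (fun i => X i ω) ηs) θ₀) (EuclideanSpace.single j 1)| ≤
        (2 * B ^ 2 + (2 + C) * B ^ 3) * (n : ℝ) ^ (-(2 * g)) := by
      intro j
      have hej := norm_single_one_le j
      have f0 := hs_diff.contDiffOn_sub_apply hGω.1.1 hθ₀ (s := 0) (by norm_num)
        (v := fun _ => EuclideanSpace.single j 1) (fun _ => hej)
        (fun z hz => (hDb hBg hD0 θ₀ hθ₀ z hz).trans hgδ)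
        (fun z hz => norm_le_of_biSup_enorm_le hBδ hE0 hz)
      have f1 := hs_diff.contDiffOn_sub_apply hGω.1.1 hθ₀ (s := 1) (by norm_num)
        (v := fun _ => EuclideanSpace.single j 1) (fun _ => hej)
        (fun z hz => (hDb hBg hD1 θ₀ hθ₀ z hz).trans hgδ)
        (fun z hz => norm_le_of_biSup_enorm_le hBδ hE1 hz)
      have w0 := norm_le_of_enorm_le_ofReal (mul_nonneg hBδ (mul_nonneg hB (hrh0 n)))
        ((hUb j n ω _ _ f0.1 f0.2.1 f0.2.2).trans ((mul_le_mul_right (hUn j) _).trans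
          (ENNReal.ofReal_mul hBδ).ge))
      have w1 := norm_le_of_enorm_le_ofReal (mul_nonneg hBδ (mul_nonneg hB (hrh0 n)))
        ((hWb n ω _ _ f1.1 f1.2.1 f1.2.2).trans ((mul_le_mul_right hWn _).trans
          (ENNReal.ofReal_mul hBδ).ge))
      simp only [thetaDeriv_zero_apply, thetaDeriv_one_apply, Real.norm_eq_abs] at w0 w1
      set T0 := (1 / n : ℝ) * ∑ i ∈ Finset.range n,
        m j (X i ω) * (ηh n ω θ₀ (X i ω).2.2 - ηs θ₀ (X i ω).2.2) with hT0
      set T1 := (1 / n : ℝ) * ∑ i ∈ Finset.range n,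
        a (X i ω) * (fderiv ℝ (fun t => ηh n ω t (X i ω).2.2) θ₀ (EuclideanSpace.single j 1) -
          fderiv ℝ (fun t => ηs t (X i ω).2.2) θ₀ (EuclideanSpace.single j 1)) with hT1
      -- What is left after removing the two centred linear terms: the pointwise quadratic remainder
      -- averaged against the envelope.
      have hrem : |(1 / n : ℝ) * (fderiv ℝ (M.profile n (fun i => X i ω) (ηh n ω)) θ₀ -
          fderiv ℝ (M.profile n (fun i => X i ω) ηs) θ₀) (EuclideanSpace.single j 1) - (T1 + T0)| ≤
          B * ((2 + C) * (B * rg n) ^ 2) := by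
        rw [hh.fderiv_eq hθ₀, hs.fderiv_eq hθ₀, hT0, hT1, ← mul_add, ← mul_sub, sub_apply,
          ← Finset.sum_add_distrib, sum_apply, sum_apply, ← Finset.sum_sub_distrib,
          ← Finset.sum_sub_distrib, abs_mul, abs_of_nonneg (by positivity : (0 : ℝ) ≤ 1 / n)]
        calc _ ≤ (1 / n : ℝ) * ∑ i ∈ Finset.range n, |A (X i ω)| * ((2 + C) * (B * rg n) ^ 2) := by
              refine mul_le_mul_of_nonneg_left ((Finset.abs_sum_le_sum_abs _ _).trans
                (Finset.sum_le_sum fun i _ => ?_)) (by positivity)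
              rw [← mul_assoc]
              exact (hGω.2.1 i).abs_scoreAlong_sub_le (hNi hθ₀) hej
                (hGseg hGω θ₀ hθ₀' _ (X i ω).2.2.2) (hC 1 (by norm_num) θ₀ hθ₀ _ (X i ω).2.2.2)
                (hDb0 hBg hD0 θ₀ hθ₀ _ (X i ω).2.2.2) (hDb hBg hD1 θ₀ hθ₀ _ (X i ω).2.2.2)
          _ ≤ _ := by
              rw [← Finset.sum_mul, ← mul_assoc]
              exact mul_le_mul_of_nonneg_right hVn (by positivity)
      have htri := abs_sub_abs_le_abs_sub ((1 / n : ℝ) *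
        (fderiv ℝ (M.profile n (fun i => X i ω) (ηh n ω)) θ₀ -
          fderiv ℝ (M.profile n (fun i => X i ω) ηs) θ₀) (EuclideanSpace.single j 1)) (T1 + T0)
      have hadd := abs_add_le T1 T0
      calc _ ≤ B * ((2 + C) * (B * rg n) ^ 2) +
            (B * rδ n * (B * rh n) + B * rδ n * (B * rh n)) := by
            linarith
        _ = 2 * B ^ 2 * (rδ n * rh n) + (2 + C) * B ^ 3 * rg n ^ 2 := by ring
        _ ≤ 2 * B ^ 2 * (n : ℝ) ^ (-(2 * g)) + (2 + C) * B ^ 3 * (n : ℝ) ^ (-(2 * g)) := by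
            rw [hrgg n hn]
            gcongr
            exact hrδh n hn
        _ = _ := by ring
    refine enorm_le_ofReal_of_norm_le ((norm_smul_iteratedFDeriv_one_sub_le _ _ _ _).trans
      ((norm_le_sum_abs_single _).trans ((Finset.sum_le_sum fun j _ => key j).trans (le_of_eq ?_))))
    rw [Finset.sum_const, Finset.card_univ, Fintype.card_fin, nsmul_eq_mul]
    ring
  · -- second derivative
    refine BigOP.of_forall (R := ![D 0, D 1, D 2, V]) (r := ![rg, rg, rg, fun _ => 1]) ?_ ?_ hG
      fun B hB => ?_
    · intro j n
      fin_cases j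
      exacts [hrg0 n, hrg0 n, hrg0 n, zero_le_one]
    · intro j
      fin_cases j
      exacts [hD 0 (by norm_num), hD 1 (by norm_num), hD 2 (by norm_num), hV]
    -- Inside the square, the radius `B n^{-g}` is replaced by `B`, using `n ≥ 1`; the outer factor
    -- keeps its rate.
    refine ⟨B * (5 * (1 + C + B) ^ 2 * B), ?_⟩
    filter_upwards [eventually_ge_atTop 1] with n hn ω hGω hR
    have hD0 : D 0 n ω ≤ ENNReal.ofReal (B * rg n) := hR 0
    have hD1 : D 1 n ω ≤ ENNReal.ofReal (B * rg n) := hR 1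
    have hD2 : D 2 n ω ≤ ENNReal.ofReal (B * rg n) := hR 2
    have hVn := hVb hB (hR 3)
    have hBg : 0 ≤ B * rg n := mul_nonneg hB (hrg0 n)
    obtain ⟨_, hh, -⟩ := hPh hGω
    obtain ⟨_, hs, -⟩ := hPs hGω
    refine iSup₂_le fun θ hθ => enorm_le_ofReal_of_norm_le ?_
    have hθN := hN'N hθ
    refine (norm_smul_iteratedFDeriv_two_sub_le _ _ _ _).trans ?_
    rw [hh.fderiv_fderiv_eq hN hθN, hs.fderiv_fderiv_eq hN hθN, ← Finset.sum_sub_distrib,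
      abs_of_nonneg (by positivity : (0 : ℝ) ≤ 1 / n)]
    calc _ ≤ (1 / n : ℝ) * ∑ i ∈ Finset.range n,
          |A (X i ω)| * (5 * (1 + C + B) ^ 2 * (B * rg n)) := by
          refine mul_le_mul_of_nonneg_left ((norm_sum_le _ _).trans
            (Finset.sum_le_sum fun i _ => ?_)) (by positivity)
          refine ((hGω.2.1 i).norm_hessianAlong_sub_le (hNi hθN)
            (hGseg hGω θ hθ _ (X i ω).2.2.2) (hC 1 (by norm_num) θ hθN _ (X i ω).2.2.2)
            (hC 2 (by norm_num) θ hθN _ (X i ω).2.2.2)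
            (hDb0 hBg hD0 θ hθN _ (X i ω).2.2.2) (hDb hBg hD1 θ hθN _ (X i ω).2.2.2)
            (hDb hBg hD2 θ hθN _ (X i ω).2.2.2)).trans ?_
          have : B * rg n ≤ B := mul_le_of_le_one_right hB (hrg1 n hn)
          rw [mul_assoc]
          gcongr
      _ ≤ B * (5 * (1 + C + B) ^ 2 * (B * rg n)) := by
          rw [← Finset.sum_mul, ← mul_assoc]
          exact mul_le_mul_of_nonneg_right hVn (by positivity)
      _ = _ := by ring
  · -- third derivative
    refine BigOP.of_forall (R := ![D 1, D 2, D 3, V]) (r := ![rg, rg, fun _ => 1, fun _ => 1])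
      ?_ ?_ hG fun B hB => ?_
    · intro j n
      fin_cases j
      exacts [hrg0 n, hrg0 n, zero_le_one, zero_le_one]
    · intro j
      fin_cases j
      exacts [hD 1 (by norm_num), hD 2 (by norm_num), hD3.bigOP, hV]
    -- The derivatives of the estimated curve of orders one to three are bounded by `C + B`: the
    -- bound for `ηs` plus that for the error.
    refine ⟨B * (5 * (1 + (C + B)) ^ 3), ?_⟩
    filter_upwards [eventually_ge_atTop 1] with n hn ω hGω hR
    have hle : B * rg n ≤ B := mul_le_of_le_one_right hB (hrg1 n hn)
    have hD1 : D 1 n ω ≤ ENNReal.ofReal B := (hR 0).trans (ENNReal.ofReal_le_ofReal hle)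
    have hD2 : D 2 n ω ≤ ENNReal.ofReal B := (hR 1).trans (ENNReal.ofReal_le_ofReal hle)
    have hD3 : D 3 n ω ≤ ENNReal.ofReal B :=
      (hR 2).trans (ENNReal.ofReal_le_ofReal (mul_one B).le)
    have hVn := hVb hB (hR 3)
    obtain ⟨f₃, hh, hf₃⟩ := hPh hGω
    refine iSup₂_le fun θ hθ => enorm_le_ofReal_of_norm_le ?_
    have hθN := hN'N hθ
    rw [norm_smul, hh.norm_iteratedFDeriv_three hN hθN, mul_one,
      Real.norm_of_nonneg (by positivity : (0 : ℝ) ≤ 1 / n)]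
    refine (mul_le_mul_of_nonneg_left (hf₃ θ hθN (C + B) fun s hs1 hs3 z hz => ?_)
      (by positivity)).trans ?_
    · have hDs : D s n ω ≤ ENNReal.ofReal B := by
        interval_cases s
        exacts [hD1, hD2, hD3]
      have h1 := norm_add_le (thetaDeriv ηs s θ z) (thetaDeriv (ηh n ω) s θ z - thetaDeriv ηs s θ z)
      rw [add_sub_cancel] at h1
      exact h1.trans (add_le_add (hC s hs3 θ hθN z hz) (hDb hB hDs θ hθN z hz))
    · rw [← mul_assoc]
      exact mul_le_mul_of_nonneg_right hVn (by positivity)
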